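/- For $y>0$ put $q=e^{-\pi y}$ and $$\theta_2=\sum_{n\in\mathbb Z}q^{(n-1/2)^2},\qquad \theta=\theta_3=\sum_{n\in\mathbb Z}q^{n^2},\qquad \theta_4=\sum_{n\in\mathbb Z}(-1)^nq^{n^2},\qquad \lambda=(\theta_2/\theta_3)^4,\qquad F_3=\theta_3^3(1-\lambda),$$ all regarded as functions of $y$, a dot denoting $d/dy$. Let $K_w(x)=\tfrac12\int_0^\infty u^{w-1}e^{-\frac x2(u+\frac1u)}\,du$ for $x>0$, $w\in\mathbb C$. Let $a$ be the multiplicative function with $a(p^f)=\sigma_1(p^f)$ for odd primes $p$ and $a(2^f)=2^f$, let $a_3(n)=2\bigl(4-(-1)^n\bigr)a(n)$, and let $b_3(m)$ be the coefficients of the power series expansion in $q$ of $\theta_3^{-1}\theta_2^4$. For $j\ge 1$ and $s\in\mathbb C$ put $$c_j(3,s)=\sum_{d\mid j}a_3(d)\,b_3\!\left(\tfrac jd\right)\left(\tfrac{j}{d^2}\right)^{\frac{3s-1}{4}}.$$ Let $\Psi_3(s)=\int_0^\infty y^{3s/2}\dot F_3(y)\,dy$. Let $\zeta^*(s,3)$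 be the function given for $0<\operatorname{Re}s<1$ by $$\zeta^*(s,3)=\frac16\int_0^\infty y^{\frac{3s}{2}-1}\left(\theta^3-1-y^{-3/2}\right)dy$$ and continued to a meromorphic function on $\mathbb C$, holomorphic away from $0$ and $1$. **Theorem.** For all $y>0$ the following expansions converge and hold: $$4\frac{\dot\theta_4}{\theta_4}-\frac{\dot\theta_3}{\theta_3}=\pi\sum_{n\ge1}a_3(n)q^n,\qquad \theta_3^{-1}\theta_2^4=\sum_{m\ge1}b_3(m)q^m .$$ The function $F_3$ is differentiable on $(0,\infty)$, and for every $s\in\mathbb C$ the integral $\Psi_3(s)$ converges absolutely and $$\Psi_3(s)=2\pi\sum_{j=1}^\infty c_j(3,s)\,K_{\frac{3s-1}{2}}(2\pi\sqrt j),$$ the series being absolutely convergent. The integral defining $\zeta^*(s,3)$ converges absolutely for $0<\operatorname{Re}s<1$ and the stated continuation exists; for $\operatorname{Re}s>1$ one has $\zeta^*(s,3)=\frac16\int_0^\infty y^{\frac{3s}{2}-1}(\theta^3-1)\,dy$ with an absolutely convergent integral; and for all $s\in\mathbb C\setminus\{0,1\}$, $$9\,\zeta^*(s,3)=-\left(\frac{\Psi_3(s)}{s}+\frac{\Psi_3(1-s)}{1-s}\right).$$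 -/

import Mathlib

open Set MeasureTheory

namespace BesselZeta

noncomputable section

/-- `θ₂` as a function of `y > 0`, with nome `q = e^{-πy}`. -/
def theta2 (y : ℝ) : ℝ := ∑' n : ℤ, Real.exp (-Real.pi * y * ((n : ℝ) - 1 / 2) ^ 2)

/-- `θ₃` as a function of `y > 0`, with nome `q = e^{-πy}`. -/
def theta3 (y : ℝ) : ℝ := ∑' n : ℤ, Real.exp (-Real.pi * y * (n : ℝ) ^ 2)

/-- `θ₄` as a function of `y > 0`, with nome `q = e^{-πy}`. -/
def theta4 (y : ℝ) : ℝ := ∑' n : ℤ, (-1 : ℝ) ^ n * Real.exp (-Real.pi * y * (n : ℝ) ^ 2)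

/-- `λ = (θ₂ / θ₃)⁴`. -/
def lam (y : ℝ) : ℝ := (theta2 y / theta3 y) ^ 4

/-- `F₃ = θ₃³ (1 - λ)`. -/
def F3 (y : ℝ) : ℝ := theta3 y ^ 3 * (1 - lam y)

/-- `Ψ₃(s) = ∫₀^∞ y^{3s/2} F₃'(y) dy`. -/
def Psi3 (s : ℂ) : ℂ := ∫ y in Ioi (0 : ℝ), (y : ℂ) ^ (3 * s / 2) * ((deriv F3 y : ℝ) : ℂ)

/-- The Bessel function `K_w(x) = ½ ∫₀^∞ u^{w-1} e^{-(x/2)(u + 1/u)} du`, for `x > 0`. -/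
def besselK (w : ℂ) (x : ℝ) : ℂ :=
  (1 / 2) * ∫ u in Ioi (0 : ℝ), (u : ℂ) ^ (w - 1) * ((Real.exp (-(x / 2) * (u + 1 / u)) : ℝ) : ℂ)

/-- The multiplicative function with `a(p^f) = σ₁(p^f)` for odd primes `p` and `a(2^f) = 2^f`:
the 2-part of `n` times the sum of the divisors of the odd part of `n`. -/
def a (n : ℕ) : ℕ := ordProj[2] n * ∑ d ∈ (ordCompl[2] n).divisors, d

/-- `a₃(n) = 2 (4 - (-1)^n) a(n)`. -/
def a3 (n : ℕ) : ℝ := 2 * (4 - (-1 : ℝ) ^ n) * (a n : ℝ)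

open Classical in
/-- The `q`-expansion `θ₃ = 1 + 2 ∑_{k ≥ 1} q^{k²}`. -/
def theta3Series : PowerSeries ℝ :=
  PowerSeries.mk fun n => if n = 0 then 1 else if ∃ k : ℕ, k ^ 2 = n then 2 else 0

open Classical in
/-- The `q`-expansion of `∑_{k ≥ 0} q^{k(k+1)}`, which is `θ₂ / (2 q^{1/4})`. -/
def theta2Series : PowerSeries ℝ :=
  PowerSeries.mk fun n => if ∃ k : ℕ, k * (k + 1) = n then 1 else 0

/-- `b₃(m)` is the coefficient of `q^m` in `θ₃⁻¹ θ₂⁴`, where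
`θ₂⁴ = 16 q (∑_{k ≥ 0} q^{k(k+1)})⁴`. -/
def b3 (m : ℕ) : ℝ :=
  PowerSeries.coeff m (theta3Series⁻¹ * (16 * PowerSeries.X * theta2Series ^ 4))

/-- `c_j(3, s) = ∑_{d ∣ j} a₃(d) b₃(j/d) (j/d²)^{(3s-1)/4}`. -/
def c3 (j : ℕ) (s : ℂ) : ℂ :=
  ∑ d ∈ j.divisors,
    (a3 d : ℂ) * (b3 (j / d) : ℂ) * ((j : ℂ) / (d : ℂ) ^ 2) ^ ((3 * s - 1) / 4)

/-- The integrand `y^{3s/2 - 1} (θ₃³ - 1 - y^{-3/2})`, used for `0 < Re s < 1`. -/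
def stripIntegrand (s : ℂ) (y : ℝ) : ℂ :=
  (y : ℂ) ^ (3 * s / 2 - 1) * ((theta3 y ^ 3 - 1 - y ^ (-(3 / 2) : ℝ) : ℝ) : ℂ)

/-- The integrand `y^{3s/2 - 1} (θ₃³ - 1)`, used for `Re s > 1`. -/
def halfPlaneIntegrand (s : ℂ) (y : ℝ) : ℂ :=
  (y : ℂ) ^ (3 * s / 2 - 1) * ((theta3 y ^ 3 - 1 : ℝ) : ℂ)

/-- `Z` is the function `ζ*(s, 3)`: it equals `(1/6) ∫₀^∞ y^{3s/2 - 1} (θ₃³ - 1 - y^{-3/2}) dy`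
in the strip `0 < Re s < 1`, and is continued to a meromorphic function on the plane,
holomorphic away from `0` and `1`. -/
structure IsZetaStar3 (Z : ℂ → ℂ) : Prop where
  meromorphic : MeromorphicOn Z univ
  holomorphic : DifferentiableOn ℂ Z {0, 1}ᶜ
  eq_integral : ∀ s : ℂ, 0 < s.re → s.re < 1 →
    Z s = (1 / 6) * ∫ y in Ioi (0 : ℝ), stripIntegrand s y

end

end BesselZeta

/-! Jacobi's identity turns F₃ into θ₄⁴/θ₃ (`F3_eq_div`), whose logarithmic derivative is π∑a₃(n)qⁿ.
Under y ↦ 1/y the functions θ₂ and θ₄ change places, so F₃(y) = y^(-3/2)·(θ₃⁻¹θ₂⁴)(1/y) (`F3_eq`).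
Hence F₃' = π y^(-3/2) ∑ a₃(n) b₃(m) exp(-π(ny + m/y)). Integrated against y^(3s/2), each term is a
K-Bessel value (`integral_bessel`), and grouping by j = nm gives the series for Ψ₃.

The interchange of sum and integral rests on `majorant`. The signs of b₃ alternate, so ∑|b₃(m)|q^m =
θ₄⁻¹θ₂⁴ (`abs_b3`). At 1/y this is y^(3/2)θ₄⁴/θ₂, of growth at most y^(3/2)e^(πy/4), while ∑a₃(n)qⁿ
decays like e^(-πy).

The arithmetic comes from Gauss's product θ₄ = ∏(1-q^k)/(1+q^k), used for formal power series
through the finite identity `gauss_finite`. Its logarithmic derivative is a Lambert series with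
coefficients 2a(n). The resulting recursion for 1/θ₄ shows that its coefficients are nonnegative and
that it converges in the unit disc; this supplies both the signs of b₃ and the convergence of its
expansion.

For ζ*, the relation θ₃³λ = θ₃⁻¹θ₂⁴ gives θ₃³ = F₃(y) + y^(-3/2)F₃(1/y). Integration by parts turns
the first part into -(2/3)Ψ₃(s)/s, and inversion gives the same with 1-s for the second. As Ψ₃ is
entire, the right side is the continuation, unique by the identity theorem. -/

namespace BesselZeta

noncomputable section

open PowerSeries

/-! ### Gauss's product for the theta series, in finite form -/

section GaussFinite

variable {R : Type*} [CommRing R]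

/-- The product of `(1 - x^k) v_k` over `s < k ≤ n`, where `v_k` stands for `1 / (1 + x^k)`. -/
def gaussProd (x : R) (v : ℕ → R) (n s : ℕ) : R := ∏ k ∈ Finset.Ioc s n, (1 - x ^ k) * v k

lemma gaussProd_self (x : R) (v : ℕ → R) (n : ℕ) : gaussProd x v n n = 1 := by simp [gaussProd]

lemma gaussProd_succ (x : R) (v : ℕ → R) {n s : ℕ} (h : s ≤ n) :
    gaussProd x v (n + 1) s = gaussProd x v n s * ((1 - x ^ (n + 1)) * v (n + 1)) := by
  rw [gaussProd, gaussProd, Finset.prod_Ioc_succ_top h]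

lemma gaussProd_eq_mul (x : R) (v : ℕ → R) {n s : ℕ} (h : s < n) :
    gaussProd x v n s = (1 - x ^ (s + 1)) * v (s + 1) * gaussProd x v n (s + 1) := by
  rw [gaussProd, gaussProd, ← Finset.insert_Ioc_add_one_left_eq_Ioc h,
    Finset.prod_insert (by simp)]

/-- Passing from `n` to `n + 1` changes the right side of `gauss_finite` term by term; these
changes, summed up to `m`, telescope. The case `m = n` drives the induction there. -/
lemma gauss_telescope (x : R) (v : ℕ → R) (hv : ∀ k, 1 ≤ k → v k * (1 + x ^ k) = 1) (n m : ℕ)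
    (hm : m ≤ n) :
    gaussProd x v n 0 * ((1 - x ^ (n + 1)) * v (n + 1) - 1) +
      ∑ s ∈ Finset.range m, 2 * (-1) ^ (s + 1) * v (s + 1) * gaussProd x v n (s + 1) *
        ((1 - x ^ (n + 1)) * v (n + 1) * x ^ ((s + 1) * (n + 2)) - x ^ ((s + 1) * (n + 1))) =
    -(2 * (-1) ^ m * v (n + 1) * gaussProd x v n m * x ^ ((m + 1) * (n + 1))) := by
  have hN := hv (n + 1) (by omega)
  induction m with
  | zero =>
    simp only [Finset.range_zero, Finset.sum_empty, pow_zero, zero_add, one_mul]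
    linear_combination gaussProd x v n 0 * hN
  | succ m ih =>
    rw [Finset.sum_range_succ, ← add_assoc, ih (by omega), gaussProd_eq_mul x v (by omega : m < n)]
    have hs := hv (m + 1) (by omega)
    have e1 : x ^ ((m + 1) * (n + 2)) = x ^ ((m + 1) * (n + 1)) * x ^ (m + 1) := by
      rw [← pow_add]; ring_nf
    have e2 : x ^ ((m + 1 + 1) * (n + 1)) = x ^ ((m + 1) * (n + 1)) * x ^ (n + 1) := by
      rw [← pow_add]; ring_nf
    rw [e1, e2, pow_succ (-1 : R) m]
    generalize x ^ (m + 1) = a at *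
    generalize x ^ (n + 1) = b at *
    generalize x ^ ((m + 1) * (n + 1)) = c at *
    generalize gaussProd x v n (m + 1) = Q at *
    generalize v (m + 1) = vs at *
    generalize v (n + 1) = w at *
    linear_combination (2 * (-1 : R) ^ m * -1 * Q * c) * (vs * hN - w * b * hs)

/-- Shanks' finite form of Gauss's identity `∑ (-1)^s x^(s^2) = ∏ (1 - x^k) / (1 + x^k)`. -/
lemma gauss_finite (x : R) (v : ℕ → R) (hv : ∀ k, 1 ≤ k → v k * (1 + x ^ k) = 1) (n : ℕ) :
    1 + ∑ s ∈ Finset.range n, 2 * (-1) ^ (s + 1) * x ^ ((s + 1) ^ 2) =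
      gaussProd x v n 0 + ∑ s ∈ Finset.range n, 2 * (-1) ^ (s + 1) * v (s + 1) *
        gaussProd x v n (s + 1) * x ^ ((s + 1) * (n + 1)) := by
  induction n with
  | zero => simp [gaussProd]
  | succ n ih =>
    have key := gauss_telescope x v hv n n le_rfl
    have hN := hv (n + 1) (by omega)
    rw [Finset.sum_range_succ, ← add_assoc, ih, Finset.sum_range_succ _ n, gaussProd_self,
      gaussProd_succ x v (Nat.zero_le n)]
    rw [gaussProd_self] at key
    have e : ∀ s ∈ Finset.range n, 2 * (-1) ^ (s + 1) * v (s + 1) *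
        gaussProd x v (n + 1) (s + 1) * x ^ ((s + 1) * (n + 1 + 1)) =
        2 * (-1) ^ (s + 1) * v (s + 1) * gaussProd x v n (s + 1) * x ^ ((s + 1) * (n + 1)) +
        2 * (-1) ^ (s + 1) * v (s + 1) * gaussProd x v n (s + 1) *
        ((1 - x ^ (n + 1)) * v (n + 1) * x ^ ((s + 1) * (n + 2)) - x ^ ((s + 1) * (n + 1))) := by
      intro s hs
      rw [gaussProd_succ x v (by simpa using hs)]
      ring
    rw [Finset.sum_congr rfl e, Finset.sum_add_distrib]
    have e2 : x ^ ((n + 1) * (n + 1 + 1)) = x ^ ((n + 1) * (n + 1)) * x ^ (n + 1) := by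
      rw [← pow_add]; ring_nf
    rw [e2, show (n + 1) ^ 2 = (n + 1) * (n + 1) by ring]
    rw [pow_succ (-1 : R) n]
    linear_combination -key + 2 * (-1) ^ n * x ^ ((n + 1) * (n + 1)) * hN

end GaussFinite

/-! ### The logarithmic derivative of the theta series -/

/-- The derivation `X d/dX`. -/
def eulerD (f : PowerSeries ℝ) : PowerSeries ℝ := X * derivative ℝ f

lemma coeff_eulerD (f : PowerSeries ℝ) (n : ℕ) : coeff n (eulerD f) = n * coeff n f := by
  cases n with
  | zero => simp [eulerD]
  | succ n => simp [eulerD, coeff_succ_X_mul, coeff_derivative]; ring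

lemma eulerD_mul (f g : PowerSeries ℝ) : eulerD (f * g) = eulerD f * g + f * eulerD g := by
  simp only [eulerD, Derivation.leibniz, smul_eq_mul]; ring

lemma eulerD_X_pow (k : ℕ) : eulerD (X ^ k) = (k : PowerSeries ℝ) * X ^ k := by
  cases k with
  | zero => simp [eulerD]
  | succ k => simp [eulerD, Derivation.leibniz_pow]; ring

/-- The `q`-expansion of `θ₄`. -/
def theta4Series : PowerSeries ℝ := rescale (-1) theta3Series

/-- The series `1 / (1 + X^k)`. -/
def invOneAdd (k : ℕ) : PowerSeries ℝ := (1 + X ^ k)⁻¹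

lemma invOneAdd_mul (k : ℕ) (hk : 1 ≤ k) : invOneAdd k * (1 + X ^ k) = 1 :=
  PowerSeries.inv_mul_cancel _ (by simp [show k ≠ 0 by omega])

/-- Every correction term in `gauss_finite` is divisible by `X ^ (n + 1)`, so the finite product
already agrees with θ₄ up to degree `n`. -/
lemma coeff_gaussProd {n N : ℕ} (h : N ≤ n) :
    coeff N (gaussProd X invOneAdd n 0) = coeff N theta4Series := by
  have key := congrArg (coeff N) (gauss_finite (X : PowerSeries ℝ) invOneAdd invOneAdd_mul n)
  rw [map_add, map_add, map_sum, map_sum] at key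
  rw [Finset.sum_eq_zero (s := Finset.range n) (f := fun s => coeff N (2 * (-1) ^ (s + 1) *
    invOneAdd (s + 1) * gaussProd X invOneAdd n (s + 1) * X ^ ((s + 1) * (n + 1)))), add_zero]
    at key
  · rw [← key, theta4Series, coeff_rescale, theta3Series, coeff_mk]
    have e : ∀ s : ℕ, coeff N (2 * (-1) ^ (s + 1) * X ^ ((s + 1) ^ 2) : PowerSeries ℝ) =
        if N = (s + 1) ^ 2 then 2 * (-1) ^ (s + 1) else 0 := by
      intro s
      rw [show (2 * (-1) ^ (s + 1) * X ^ ((s + 1) ^ 2) : PowerSeries ℝ) =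
        C (2 * (-1) ^ (s + 1) : ℝ) * X ^ ((s + 1) ^ 2) by
          simp [show (C (2 : ℝ)) = (2 : PowerSeries ℝ) from map_ofNat C 2], coeff_C_mul, coeff_X_pow]
      simp
    simp_rw [e]
    by_cases h0 : N = 0
    · subst h0
      have e0 : ∀ s : ℕ, 0 ≠ (s + 1) ^ 2 := fun s => by positivity
      simp [e0]
    · rw [coeff_one, if_neg h0, if_neg h0, zero_add]
      by_cases hs : ∃ k : ℕ, k ^ 2 = N
      · rw [if_pos hs]
        obtain ⟨k, rfl⟩ := hs
        have hk : k ≠ 0 := by rintro rfl; simp at h0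
        obtain ⟨j, rfl⟩ := Nat.exists_eq_succ_of_ne_zero hk
        rw [Finset.sum_eq_single j]
        · simp only [Nat.succ_eq_add_one, if_true]
          rw [mul_comm, pow_two, pow_mul]
          congr 1
          rcases Nat.even_or_odd (j + 1) with h | h
          · simp [h.neg_one_pow]
          · simp [h.neg_one_pow]
        · intro b _ hb
          rw [if_neg]
          intro h'
          have := Nat.pow_left_injective (n := 2) (by norm_num) h'
          simp at this
          omega
        · intro hj
          exfalso; apply hj
          simp only [Finset.mem_range, Nat.succ_eq_add_one] at *
          nlinarith
      · rw [if_neg hs, mul_zero]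
        refine Finset.sum_eq_zero fun s _ => if_neg ?_
        intro h'; exact hs ⟨_, h'.symm⟩
  · intro s _
    rw [coeff_mul_X_pow', if_neg]
    nlinarith

/-- The Lambert term `2 k X^k / (1 - X^(2k))`. -/
def lambertTerm (k : ℕ) : PowerSeries ℝ := mk fun N => if k ∣ N ∧ Odd (N / k) then 2 * (k : ℝ) else 0

lemma lambertTerm_mul (k : ℕ) (hk : 1 ≤ k) :
    lambertTerm k * (1 - X ^ (2 * k)) = 2 * (k : PowerSeries ℝ) * X ^ k := by
  ext N
  rw [mul_sub, mul_one, map_sub, coeff_mul_X_pow',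
    show (2 * (k : PowerSeries ℝ) * X ^ k) = C (2 * (k : ℝ)) * X ^ k by
      simp [show (C (2 : ℝ)) = (2 : PowerSeries ℝ) from map_ofNat C 2], coeff_C_mul,
    coeff_X_pow]
  simp only [lambertTerm, coeff_mk]
  by_cases hd : k ∣ N
  · obtain ⟨m, rfl⟩ := hd
    have e1 : k * m / k = m := Nat.mul_div_cancel_left m (by omega)
    by_cases h2 : 2 * k ≤ k * m
    · have h2' : 2 ≤ m := by nlinarith
      obtain ⟨j, rfl⟩ := Nat.exists_eq_add_of_le h2'
      have e2 : k * (2 + j) - 2 * k = k * j := by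
        rw [mul_add]; omega
      have e3 : k * j / k = j := Nat.mul_div_cancel_left j (by omega)
      have e4 : k * (2 + j) ≠ k := by nlinarith
      rw [if_pos h2, e1, e2, e3, if_neg e4]
      simp [Nat.odd_add, show ¬ Odd 2 by decide]
    · have : m < 2 := by nlinarith
      interval_cases m
      · simp [show k ≠ 0 by omega, show (0 : ℕ) ≠ k by omega]
      · simp [show ¬ 2 * k ≤ k by omega, show k / k = 1 from Nat.div_self (by omega)]
  · have h1 : N ≠ k := by rintro rfl; simp at hd
    rw [if_neg (by tauto), if_neg h1]
    by_cases h2 : 2 * k ≤ N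
    · rw [if_pos h2, if_neg]
      · simp
      · rintro ⟨h3, _⟩
        exact hd ((Nat.dvd_sub_iff_left h2 (Dvd.intro_left 2 rfl)).1 h3)
    · simp [h2]

/-- Logarithmic differentiation of (1-X^k)/(1+X^k) gives -kX^k/(1-X^k) - kX^k/(1+X^k) =
-2kX^k/(1-X^(2k)). The proof clears denominators with (1+X^k)², which is invertible. -/
lemma eulerD_gaussFactor (k : ℕ) (hk : 1 ≤ k) :
    eulerD ((1 - X ^ k) * invOneAdd k) = -(lambertTerm k) * ((1 - X ^ k) * invOneAdd k) := by
  have hv := invOneAdd_mul k hk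
  set r := (1 - X ^ k) * invOneAdd k with hr
  have h1 : r * (1 + X ^ k) = 1 - X ^ k := by rw [hr]; linear_combination (1 - X ^ k) * hv
  have hD : eulerD (1 : PowerSeries ℝ) = 0 := by simp [eulerD]
  have hDadd : ∀ f g : PowerSeries ℝ, eulerD (f + g) = eulerD f + eulerD g := by
    intro f g; simp [eulerD, mul_add]
  have hDsub : ∀ f g : PowerSeries ℝ, eulerD (f - g) = eulerD f - eulerD g := by
    intro f g; simp [eulerD, mul_sub]
  have h2 := congrArg eulerD h1
  rw [eulerD_mul, hDadd, hDsub, hD, eulerD_X_pow] at h2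
  have h3 := lambertTerm_mul k hk
  have h4 : (eulerD r + lambertTerm k * r) * (1 + X ^ k) ^ 2 = 0 := by
    rw [mul_comm 2 k, pow_mul] at h3
    linear_combination (1 + X ^ k) * h2 + h3 +
      (lambertTerm k * (1 + X ^ k) - (k : PowerSeries ℝ) * X ^ k) * h1
  have h5 : eulerD r + lambertTerm k * r = 0 := by
    have : (eulerD r + lambertTerm k * r) =
      (eulerD r + lambertTerm k * r) * (1 + X ^ k) ^ 2 * (invOneAdd k) ^ 2 := by
      rw [mul_assoc, ← mul_pow, mul_comm _ (invOneAdd k), hv]; ring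
    rw [this, h4, zero_mul]
  linear_combination h5

lemma eulerD_gaussProd (n : ℕ) :
    eulerD (gaussProd X invOneAdd n 0) =
      -(∑ k ∈ Finset.Ioc 0 n, lambertTerm k) * gaussProd X invOneAdd n 0 := by
  induction n with
  | zero => simp [gaussProd, eulerD]
  | succ n ih =>
    rw [gaussProd_succ _ _ (Nat.zero_le n), eulerD_mul, ih, eulerD_gaussFactor _ (by omega),
      Finset.sum_Ioc_succ_top (by omega)]
    ring

/-- When N/k is odd, k contains the full power of 2 in N, so such k are that power times a divisor
of the odd part. Lambert series produce `a` in this form. -/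
lemma a_eq_sum (N : ℕ) : a N = ∑ k ∈ N.divisors with Odd (N / k), k := by
  rcases eq_or_ne N 0 with rfl | hN
  · simp [a]
  rw [a, Finset.mul_sum]
  have hfac := Nat.ordProj_mul_ordCompl_eq_self N 2
  set P := ordProj[2] N with hP
  set M := ordCompl[2] N with hM
  have hM2 : ¬ 2 ∣ M := Nat.not_dvd_ordCompl Nat.prime_two hN
  have hPpos : 0 < P := by positivity
  have hMpos : M ≠ 0 := by rintro h; rw [h] at hM2; simp at hM2
  have hcop : ∀ j : ℕ, Odd j → Nat.Coprime P j := fun j hj => by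
    rw [hP]; exact Nat.Coprime.pow_left _ (Nat.coprime_two_left.2 hj)
  refine Finset.sum_bij (fun d _ => P * d) ?_ ?_ ?_ ?_
  · intro d hd
    rw [Nat.mem_divisors] at hd
    obtain ⟨⟨e, he⟩, _⟩ := hd
    have hd0 : 0 < d := Nat.pos_of_ne_zero (by rintro rfl; simp at he; omega)
    have : N = P * d * e := by rw [← hfac, he]; ring
    rw [Finset.mem_filter, Nat.mem_divisors]
    refine ⟨⟨⟨e, this⟩, hN⟩, ?_⟩
    rw [this, Nat.mul_div_cancel_left _ (by positivity)]
    rw [← Nat.not_even_iff_odd, even_iff_two_dvd]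
    intro h; exact hM2 (he ▸ Dvd.dvd.mul_left h d)
  · intro x _ y _ h
    exact Nat.eq_of_mul_eq_mul_left hPpos h
  · intro k hk
    rw [Finset.mem_filter, Nat.mem_divisors] at hk
    obtain ⟨⟨⟨e, he⟩, _⟩, hodd⟩ := hk
    have hk0 : 0 < k := Nat.pos_of_ne_zero (by rintro rfl; simp at he; omega)
    rw [he, Nat.mul_div_cancel_left _ hk0] at hodd
    have hPk : P ∣ k := (hcop e hodd).dvd_of_dvd_mul_right (he ▸ ⟨M, hfac.symm⟩)
    obtain ⟨d, rfl⟩ := hPk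
    refine ⟨d, ?_, rfl⟩
    rw [Nat.mem_divisors]
    refine ⟨⟨e, ?_⟩, hMpos⟩
    apply Nat.eq_of_mul_eq_mul_left hPpos
    rw [hfac, he]; ring
  · intros; rfl

/-- The series `∑ 2 a(n) X^n`. -/
def lambertSeries : PowerSeries ℝ := mk fun n => 2 * (a n : ℝ)

lemma coeff_sum_lambertTerm {n i : ℕ} (h : i ≤ n) :
    coeff i (∑ k ∈ Finset.Ioc 0 n, lambertTerm k) = coeff i lambertSeries := by
  rw [map_sum, lambertSeries, coeff_mk, a_eq_sum]
  simp only [lambertTerm, coeff_mk]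
  rw [← Finset.sum_filter, Nat.cast_sum, Finset.mul_sum]
  rcases Nat.eq_zero_or_pos i with rfl | hi
  · simp
  refine Finset.sum_congr ?_ fun _ _ => rfl
  ext k
  simp only [Finset.mem_filter, Finset.mem_Ioc, Nat.mem_divisors]
  constructor
  · rintro ⟨_, h1, h2⟩; exact ⟨⟨h1, by omega⟩, h2⟩
  · rintro ⟨⟨h1, _⟩, h2⟩
    exact ⟨⟨Nat.pos_of_dvd_of_pos h1 hi, (Nat.le_of_dvd hi h1).trans h⟩, h1, h2⟩

/-- The coefficient of degree `N` involves only factors with k ≤ N, so the identity for finite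
products can be read off degree by degree. -/
lemma eulerD_theta4Series : eulerD theta4Series = -(lambertSeries * theta4Series) := by
  ext N
  have h := congrArg (coeff N) (eulerD_gaussProd N)
  rw [coeff_eulerD, coeff_gaussProd le_rfl, neg_mul, map_neg, coeff_mul] at h
  rw [coeff_eulerD, h, map_neg, coeff_mul]
  congr 1
  refine Finset.sum_congr rfl fun p hp => ?_
  rw [Finset.HasAntidiagonal.mem_antidiagonal] at hp
  rw [coeff_sum_lambertTerm (by omega), coeff_gaussProd (by omega)]

lemma constantCoeff_theta3Series : constantCoeff theta3Series = 1 := by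
  rw [← coeff_zero_eq_constantCoeff_apply, theta3Series, coeff_mk, if_pos rfl]

lemma constantCoeff_theta4Series : constantCoeff theta4Series = 1 := by
  rw [← coeff_zero_eq_constantCoeff_apply, theta4Series, coeff_rescale,
    coeff_zero_eq_constantCoeff_apply, constantCoeff_theta3Series]; simp

/-! ### The reciprocal of θ₄ -/

lemma theta4Series_mul_inv : theta4Series * theta4Series⁻¹ = 1 :=
  PowerSeries.mul_inv_cancel _ (by simp [constantCoeff_theta4Series])

lemma eulerD_inv_theta4Series : eulerD theta4Series⁻¹ = lambertSeries * theta4Series⁻¹ := by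
  have h := congrArg eulerD theta4Series_mul_inv
  rw [eulerD_mul, eulerD_theta4Series] at h
  have hD : eulerD (1 : PowerSeries ℝ) = 0 := by simp [eulerD]
  rw [hD] at h
  linear_combination theta4Series⁻¹ * h +
    (lambertSeries * theta4Series⁻¹ - eulerD theta4Series⁻¹) * theta4Series_mul_inv

lemma coeff_inv_theta4Series_recursion (n : ℕ) :
    (n : ℝ) * coeff n theta4Series⁻¹ =
      ∑ p ∈ Finset.HasAntidiagonal.antidiagonal n, 2 * (a p.1 : ℝ) * coeff p.2 theta4Series⁻¹ := by
  rw [← coeff_eulerD, eulerD_inv_theta4Series, coeff_mul]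
  simp [lambertSeries]

lemma a_zero : a 0 = 0 := by simp [a]

/-- Since a(0) = 0, the recursion writes n times the n-th coefficient as a nonnegative combination
of earlier ones. -/
lemma coeff_inv_theta4Series_nonneg (n : ℕ) : 0 ≤ coeff n theta4Series⁻¹ := by
  induction n using Nat.strong_induction_on with
  | _ n ih =>
    rcases Nat.eq_zero_or_pos n with rfl | hn
    · simp [constantCoeff_theta4Series]
    have h := coeff_inv_theta4Series_recursion n
    have h2 : 0 ≤ (n : ℝ) * coeff n theta4Series⁻¹ := by
      rw [h]
      refine Finset.sum_nonneg fun p hp => ?_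
      rw [Finset.HasAntidiagonal.mem_antidiagonal] at hp
      rcases Nat.eq_zero_or_pos p.1 with h0 | h0
      · simp [h0, a_zero]
      · exact mul_nonneg (by positivity) (ih _ (by omega))
    exact nonneg_of_mul_nonneg_right h2 (by exact_mod_cast hn)

lemma a_le (n : ℕ) : a n ≤ n ^ 2 := by
  rw [a_eq_sum]
  calc _ ≤ ∑ k ∈ n.divisors, k := Finset.sum_le_sum_of_subset (Finset.filter_subset _ _)
    _ ≤ ∑ k ∈ n.divisors, n := Finset.sum_le_sum fun k hk => Nat.divisor_le hk
    _ = n.divisors.card * n := by simp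
    _ ≤ n * n := Nat.mul_le_mul_right _ (Nat.card_divisors_le_self n)
    _ = n ^ 2 := by ring

/-! ### Power series convergent in the unit disc -/

/-- The power series converges absolutely in the open unit disc. -/
def ConvDisc (f : PowerSeries ℝ) : Prop :=
  ∀ r : ℝ, 0 ≤ r → r < 1 → Summable fun n => ‖coeff n f * r ^ n‖

/-- The value of a power series at the nome `q = e^{-πy}`. -/
def qval (f : PowerSeries ℝ) (y : ℝ) : ℝ := ∑' n, coeff n f * Real.exp (-Real.pi * y) ^ n

lemma nome_lt_one {y : ℝ} (hy : 0 < y) : Real.exp (-Real.pi * y) < 1 := by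
  rw [Real.exp_lt_one_iff]; nlinarith [Real.pi_pos]

lemma ConvDisc.summable_norm {f : PowerSeries ℝ} (hf : ConvDisc f) {y : ℝ} (hy : 0 < y) :
    Summable fun n => ‖coeff n f * Real.exp (-Real.pi * y) ^ n‖ :=
  hf _ (Real.exp_pos _).le (nome_lt_one hy)

lemma ConvDisc.hasSum {f : PowerSeries ℝ} (hf : ConvDisc f) {y : ℝ} (hy : 0 < y) :
    HasSum (fun n => coeff n f * Real.exp (-Real.pi * y) ^ n) (qval f y) :=
  (hf.summable_norm hy).of_norm.hasSum

lemma antidiagonal_sum_eq (f g : PowerSeries ℝ) (r : ℝ) (n : ℕ) :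
    ∑ p ∈ Finset.HasAntidiagonal.antidiagonal n, coeff p.1 f * r ^ p.1 * (coeff p.2 g * r ^ p.2) =
      coeff n (f * g) * r ^ n := by
  rw [coeff_mul, Finset.sum_mul]
  refine Finset.sum_congr rfl fun p hp => ?_
  rw [Finset.HasAntidiagonal.mem_antidiagonal] at hp
  rw [← hp, pow_add]; ring

lemma ConvDisc.mul {f g : PowerSeries ℝ} (hf : ConvDisc f) (hg : ConvDisc g) :
    ConvDisc (f * g) := by
  intro r h0 h1
  have := summable_norm_sum_mul_antidiagonal_of_summable_norm (hf r h0 h1) (hg r h0 h1)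
  simpa only [antidiagonal_sum_eq] using this

lemma qval_mul {f g : PowerSeries ℝ} (hf : ConvDisc f) (hg : ConvDisc g) {y : ℝ} (hy : 0 < y) :
    qval (f * g) y = qval f y * qval g y := by
  have := tsum_mul_tsum_eq_tsum_sum_antidiagonal_of_summable_norm
    (hf.summable_norm hy) (hg.summable_norm hy)
  simp only [antidiagonal_sum_eq] at this
  exact this.symm

lemma convDisc_C (c : ℝ) : ConvDisc (C c) := by
  intro r _ _
  refine summable_of_ne_finset_zero (s := {0}) fun n hn => ?_
  simp only [Finset.mem_singleton] at hn
  simp [coeff_C, hn]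

lemma qval_C (c y : ℝ) : qval (C c) y = c := by
  rw [qval, tsum_eq_single 0]
  · simp
  · intro n hn; simp [coeff_C, hn]

lemma convDisc_X : ConvDisc X := by
  intro r _ _
  refine summable_of_ne_finset_zero (s := {1}) fun n hn => ?_
  simp only [Finset.mem_singleton] at hn
  simp [coeff_X, hn]

lemma qval_X (y : ℝ) : qval X y = Real.exp (-Real.pi * y) := by
  rw [qval, tsum_eq_single 1]
  · simp
  · intro n hn; simp [coeff_X, hn]

lemma convDisc_one : ConvDisc 1 := by simpa using convDisc_C 1

lemma qval_one (y : ℝ) : qval 1 y = 1 := by simpa using qval_C 1 y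

lemma ConvDisc.pow {f : PowerSeries ℝ} (hf : ConvDisc f) (k : ℕ) : ConvDisc (f ^ k) := by
  induction k with
  | zero => simpa using convDisc_one
  | succ k ih => rw [pow_succ]; exact ih.mul hf

lemma qval_pow {f : PowerSeries ℝ} (hf : ConvDisc f) (k : ℕ) {y : ℝ} (hy : 0 < y) :
    qval (f ^ k) y = qval f y ^ k := by
  induction k with
  | zero => simp [qval_one]
  | succ k ih => rw [pow_succ, qval_mul (hf.pow k) hf hy, ih, pow_succ]

lemma ConvDisc.sub {f g : PowerSeries ℝ} (hf : ConvDisc f) (hg : ConvDisc g) :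
    ConvDisc (f - g) := by
  intro r h0 h1
  have := ((hf r h0 h1).of_norm.sub (hg r h0 h1).of_norm).norm
  simpa [sub_mul] using this

lemma qval_sub {f g : PowerSeries ℝ} (hf : ConvDisc f) (hg : ConvDisc g) {y : ℝ} (hy : 0 < y) :
    qval (f - g) y = qval f y - qval g y := by
  have := ((hf.hasSum hy).sub (hg.hasSum hy)).tsum_eq
  rw [← this, qval]
  simp [sub_mul]

lemma convDisc_of_le_sq {f : PowerSeries ℝ} {c : ℝ} (h : ∀ n : ℕ, |coeff n f| ≤ c * n ^ 2 + c) :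
    ConvDisc f := by
  intro r h0 h1
  have hr : ‖r‖ < 1 := by rwa [Real.norm_of_nonneg h0]
  have h2 := (summable_pow_mul_geometric_of_norm_lt_one 2 hr).mul_left c
  have h3 := (summable_geometric_of_norm_lt_one hr).mul_left c
  refine Summable.of_nonneg_of_le (fun _ => norm_nonneg _) (fun n => ?_) (h2.add h3)
  rw [norm_mul, Real.norm_eq_abs, Real.norm_of_nonneg (pow_nonneg h0 n)]
  calc _ ≤ (c * n ^ 2 + c) * r ^ n := mul_le_mul_of_nonneg_right (h n) (pow_nonneg h0 n)
    _ = _ := by ring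

lemma ConvDisc.rescale_neg_one {f : PowerSeries ℝ} (hf : ConvDisc f) :
    ConvDisc (rescale (-1) f) := by
  intro r h0 h1
  simpa [coeff_rescale] using hf r h0 h1

lemma ConvDisc.eulerD {f : PowerSeries ℝ} (hf : ConvDisc f) : ConvDisc (eulerD f) := by
  intro r h0 h1
  obtain ⟨R, hR, hR1⟩ := exists_between h1
  have hR0 : 0 < R := h0.trans_lt hR
  have h2 : Summable fun n : ℕ => ‖(n : ℝ) ^ 1 * (r / R) ^ n‖ :=
    summable_norm_pow_mul_geometric_of_norm_lt_one 1
      (by rw [Real.norm_of_nonneg (by positivity)]; exact (div_lt_one hR0).2 hR)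
  have h3 := (hf R hR0.le hR1)
  have := h2.mul_of_nonneg h3 (fun _ => norm_nonneg _) (fun _ => norm_nonneg _)
  -- The product family is summable over all pairs; only its diagonal is needed.
  refine (this.comp_injective (i := fun n : ℕ => (n, n)) fun a b h => by simpa using h).congr
    fun n => ?_
  simp only [Function.comp, ← norm_mul, coeff_eulerD, pow_one, div_pow]
  congr 1
  field_simp

lemma hasDerivAt_qval {f : PowerSeries ℝ} (hf : ConvDisc f) {y : ℝ} (hy : 0 < y) :
    HasDerivAt (qval f) (-Real.pi * qval (eulerD f) y) y := by
  -- On (t, ∞) the differentiated terms are dominated by their values at t, which permits termwise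
  -- differentiation at y.
  obtain ⟨t, ht0, hty⟩ := exists_between hy
  have hd : ∀ (n : ℕ) (z : ℝ), HasDerivAt (fun z => coeff n f * Real.exp (-Real.pi * z) ^ n)
      (-Real.pi * (coeff n (eulerD f) * Real.exp (-Real.pi * z) ^ n)) z := by
    intro n z
    have h1 : HasDerivAt (fun z => coeff n f * Real.exp (n * (-Real.pi * z)))
      (coeff n f * (Real.exp (n * (-Real.pi * z)) * (n * (-Real.pi * 1)))) z :=
      ((((hasDerivAt_id z).const_mul (-Real.pi)).const_mul (n : ℝ)).exp).const_mul _
    simp only [Real.exp_nat_mul] at h1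
    convert h1 using 1
    rw [coeff_eulerD]; ring
  have := hasDerivAt_tsum_of_isPreconnected (u := fun n =>
      Real.pi * ‖coeff n (eulerD f) * Real.exp (-Real.pi * t) ^ n‖)
    ((hf.eulerD.summable_norm ht0).mul_left _) isOpen_Ioi isPreconnected_Ioi
    (t := Ioi t) (g := fun n z => coeff n f * Real.exp (-Real.pi * z) ^ n)
    (fun n z _ => hd n z) (fun n z hz => ?_) hty (hf.hasSum hy).summable hty
  · rw [tsum_mul_left] at this
    exact this
  · rw [norm_mul, norm_neg, Real.norm_of_nonneg Real.pi_pos.le, norm_mul, norm_mul]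
    gcongr
    rw [Real.norm_of_nonneg (by positivity), Real.norm_of_nonneg (by positivity)]
    have : t < z := hz
    exact pow_le_pow_left₀ (Real.exp_pos _).le
      (Real.exp_le_exp.2 (by nlinarith [Real.pi_pos])) n

lemma continuousOn_qval {f : PowerSeries ℝ} (hf : ConvDisc f) : ContinuousOn (qval f) (Ioi 0) :=
  fun _ hy => (hasDerivAt_qval hf hy).continuousAt.continuousWithinAt

lemma qval_nonneg {f : PowerSeries ℝ} (h : ∀ n, 0 ≤ coeff n f) (y : ℝ) : 0 ≤ qval f y :=
  tsum_nonneg fun n => mul_nonneg (h n) (by positivity)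

lemma abs_qval_le {f : PowerSeries ℝ} (hf : ConvDisc f) (h0 : coeff 0 f = 0) :
    ∃ c : ℝ, 0 ≤ c ∧ ∀ y : ℝ, 1 ≤ y → |qval f y| ≤ c * Real.exp (-Real.pi * y) := by
  have hs := hf.summable_norm one_pos
  refine ⟨(∑' n, ‖coeff n f * Real.exp (-Real.pi * 1) ^ n‖) * Real.exp Real.pi,
    mul_nonneg (tsum_nonneg fun _ => norm_nonneg _) (Real.exp_pos _).le, fun y hy => ?_⟩
  rw [← Real.norm_eq_abs, mul_assoc, ← tsum_mul_right]
  refine tsum_of_norm_bounded ((hs.mul_right _).hasSum) fun n => ?_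
  rcases Nat.eq_zero_or_pos n with rfl | hn
  · simp [h0]
  rw [norm_mul, norm_mul, mul_assoc]
  gcongr
  rw [Real.norm_of_nonneg (by positivity), Real.norm_of_nonneg (by positivity), ← Real.exp_nat_mul,
    ← Real.exp_nat_mul, ← Real.exp_add, ← Real.exp_add]
  gcongr
  have h1 : (1 : ℝ) ≤ n := by exact_mod_cast hn
  -- The exponents compare because (n-1)(y-1) ≥ 0; this is why the constant carries e^π.
  nlinarith [mul_nonneg (mul_nonneg (sub_nonneg.2 h1) (sub_nonneg.2 hy)) Real.pi_pos.le]

/-! ### The `q`-expansions -/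

lemma convDisc_theta3Series : ConvDisc theta3Series := by
  refine convDisc_of_le_sq (c := 2) fun n => ?_
  have : (0 : ℝ) ≤ 2 * (n : ℝ) ^ 2 := by positivity
  rw [theta3Series, coeff_mk]
  split_ifs <;> norm_num <;> linarith

lemma convDisc_theta4Series : ConvDisc theta4Series := convDisc_theta3Series.rescale_neg_one

lemma convDisc_theta2Series : ConvDisc theta2Series := by
  refine convDisc_of_le_sq (c := 2) fun n => ?_
  have : (0 : ℝ) ≤ 2 * (n : ℝ) ^ 2 := by positivity
  rw [theta2Series, coeff_mk]
  split_ifs <;> norm_num <;> linarith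

lemma convDisc_lambertSeries : ConvDisc lambertSeries := by
  refine convDisc_of_le_sq (c := 2) fun n => ?_
  have : (a n : ℝ) ≤ (n : ℝ) ^ 2 := by exact_mod_cast a_le n
  rw [lambertSeries, coeff_mk, abs_of_nonneg (by positivity)]
  linarith

/-- The recursion replaces any knowledge of complex zeros of θ₄. If K bounds the earlier pᵢRⁱ, then
n pₙRⁿ ≤ G·K, so once n exceeds G the bound K persists. A geometric series in r/R then dominates. -/
lemma convDisc_inv_theta4Series : ConvDisc theta4Series⁻¹ := by
  intro r h0 h1
  obtain ⟨R, hR, hR1⟩ := exists_between h1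
  have hR0 : 0 < R := h0.trans_lt hR
  set p : ℕ → ℝ := fun n => coeff n theta4Series⁻¹ with hp
  have hp0 : ∀ n, 0 ≤ p n := coeff_inv_theta4Series_nonneg
  have hsum : Summable fun n => 2 * (a n : ℝ) * R ^ n := by
    have := (convDisc_lambertSeries R hR0.le hR1).of_norm
    simpa [lambertSeries] using this
  set G := ∑' n, 2 * (a n : ℝ) * R ^ n with hG
  obtain ⟨N, hN⟩ := exists_nat_ge G
  set K := ∑ i ∈ Finset.range (N + 1), p i * R ^ i with hK
  have hK0 : 0 ≤ K := Finset.sum_nonneg fun i _ => mul_nonneg (hp0 i) (by positivity)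
  have hbound : ∀ n, p n * R ^ n ≤ K := by
    intro n
    induction n using Nat.strong_induction_on with
    | _ n ih =>
      rcases le_or_gt n N with hn | hn
      · exact Finset.single_le_sum (f := fun i => p i * R ^ i)
          (fun i _ => mul_nonneg (hp0 i) (by positivity)) (by simpa using Nat.lt_succ_of_le hn)
      · have hn' : (0 : ℝ) < n := by exact_mod_cast (Nat.zero_le N).trans_lt hn
        have h2 : (n : ℝ) * (p n * R ^ n) ≤ G * K := by
          rw [← mul_assoc, hp, coeff_inv_theta4Series_recursion, Finset.sum_mul]
          calc _ ≤ ∑ q ∈ Finset.HasAntidiagonal.antidiagonal n, 2 * (a q.1 : ℝ) * R ^ q.1 * K := by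
                refine Finset.sum_le_sum fun q hq => ?_
                rw [Finset.HasAntidiagonal.mem_antidiagonal] at hq
                rcases Nat.eq_zero_or_pos q.1 with hq0 | hq0
                · simp [hq0, a_zero]
                · have := ih q.2 (by omega)
                  calc _ = 2 * (a q.1 : ℝ) * R ^ q.1 * (p q.2 * R ^ q.2) := by
                        rw [← hq, pow_add]; ring
                    _ ≤ _ := by gcongr
            _ = (∑ i ∈ Finset.range (n + 1), 2 * (a i : ℝ) * R ^ i) * K := by
                rw [← Finset.sum_mul, Finset.Nat.sum_antidiagonal_eq_sum_range_succ_mk]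
            _ ≤ _ := by
                gcongr
                exact hsum.sum_le_tsum _ fun i _ => by positivity
        have h3 : (n : ℝ) * (p n * R ^ n) ≤ n * K := by
          refine h2.trans (mul_le_mul_of_nonneg_right (hN.trans ?_) hK0)
          exact_mod_cast hn.le
        exact le_of_mul_le_mul_left h3 hn'
  have hgeo := (summable_geometric_of_lt_one (r := r / R) (by positivity)
    ((div_lt_one hR0).2 hR)).mul_left K
  refine Summable.of_nonneg_of_le (fun _ => norm_nonneg _) (fun n => ?_) hgeo
  rw [Real.norm_of_nonneg (mul_nonneg (hp0 n) (by positivity))]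
  calc p n * r ^ n = p n * R ^ n * (r / R) ^ n := by rw [div_pow]; field_simp
    _ ≤ _ := by gcongr; exact hbound n

lemma inv_theta3Series : theta3Series⁻¹ = rescale (-1) theta4Series⁻¹ := by
  have h3 : rescale (-1) theta4Series = theta3Series := by
    ext n
    rw [theta4Series, coeff_rescale, coeff_rescale, ← mul_assoc, ← mul_pow]; simp
  have h := congrArg (rescale (-1)) theta4Series_mul_inv
  rw [map_mul, map_one, h3] at h
  have h1 : theta3Series⁻¹ * theta3Series = 1 :=
    PowerSeries.inv_mul_cancel _ (by simp [constantCoeff_theta3Series])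
  linear_combination theta3Series⁻¹ * -h + rescale (-1) theta4Series⁻¹ * h1

lemma convDisc_inv_theta3Series : ConvDisc theta3Series⁻¹ := by
  rw [inv_theta3Series]; exact convDisc_inv_theta4Series.rescale_neg_one

lemma eulerD_theta3Series :
    eulerD theta3Series = -(rescale (-1) lambertSeries * theta3Series) := by
  have h3 : rescale (-1) theta4Series = theta3Series := by
    ext n
    rw [theta4Series, coeff_rescale, coeff_rescale, ← mul_assoc, ← mul_pow]; simp
  have hD : eulerD (rescale (-1) theta4Series) = rescale (-1) (eulerD theta4Series) := by
    ext n; simp only [coeff_eulerD, coeff_rescale]; ring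
  rw [h3, eulerD_theta4Series, map_neg, map_mul, h3] at hD
  exact hD

/-- The `q`-expansion of `θ₂⁴`. -/
def theta2PowSeries : PowerSeries ℝ := 16 * X * theta2Series ^ 4

lemma theta2PowSeries_eq : theta2PowSeries = C 16 * X * theta2Series ^ 4 := by
  rw [theta2PowSeries, show (C (16 : ℝ)) = (16 : PowerSeries ℝ) from map_ofNat C 16]

lemma convDisc_theta2PowSeries : ConvDisc theta2PowSeries := by
  rw [theta2PowSeries_eq]
  exact ((convDisc_C 16).mul convDisc_X).mul (convDisc_theta2Series.pow 4)

/-- The `q`-expansion of `θ₃⁻¹ θ₂⁴`. -/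
def b3Series : PowerSeries ℝ := theta3Series⁻¹ * theta2PowSeries

/-- The `q`-expansion of `θ₄⁻¹ θ₂⁴`. -/
def absB3Series : PowerSeries ℝ := theta4Series⁻¹ * theta2PowSeries

lemma coeff_b3Series (m : ℕ) : coeff m b3Series = b3 m := rfl

lemma convDisc_b3Series : ConvDisc b3Series :=
  convDisc_inv_theta3Series.mul convDisc_theta2PowSeries

lemma convDisc_absB3Series : ConvDisc absB3Series :=
  convDisc_inv_theta4Series.mul convDisc_theta2PowSeries

lemma coeff_mul_nonneg {f g : PowerSeries ℝ} (hf : ∀ n, 0 ≤ coeff n f) (hg : ∀ n, 0 ≤ coeff n g)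
    (n : ℕ) : 0 ≤ coeff n (f * g) := by
  rw [coeff_mul]
  exact Finset.sum_nonneg fun p _ => mul_nonneg (hf _) (hg _)

lemma coeff_absB3Series_nonneg (m : ℕ) : 0 ≤ coeff m absB3Series := by
  have h2 : ∀ n, 0 ≤ coeff n theta2Series := fun n => by
    rw [theta2Series, coeff_mk]; split_ifs <;> norm_num
  have hX : ∀ n, (0 : ℝ) ≤ coeff n X := fun n => by rw [coeff_X]; split_ifs <;> norm_num
  have hC : ∀ n, (0 : ℝ) ≤ coeff n (C 16) := fun n => by rw [coeff_C]; split_ifs <;> norm_num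
  refine coeff_mul_nonneg coeff_inv_theta4Series_nonneg (fun n => ?_) m
  rw [theta2PowSeries_eq, show theta2Series ^ 4 =
    theta2Series * theta2Series * (theta2Series * theta2Series) by ring]
  exact coeff_mul_nonneg (coeff_mul_nonneg hC hX)
    (coeff_mul_nonneg (coeff_mul_nonneg h2 h2) (coeff_mul_nonneg h2 h2)) n

/-- The substitution X ↦ -X turns θ₃ into θ₄, negates the factor X, and fixes `theta2Series` because
k(k+1) is even. So (-1)^m b₃(m) is minus a nonnegative coefficient. -/
lemma abs_b3 (m : ℕ) : |b3 m| = coeff m absB3Series := by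
  have h2 : rescale (-1) theta2Series = theta2Series := by
    ext n
    rw [coeff_rescale, theta2Series, coeff_mk]
    split_ifs with h
    · obtain ⟨k, rfl⟩ := h
      rw [(Nat.even_mul_succ_self k).neg_one_pow, one_mul]
    · simp
  have hX : rescale (-1) (X : PowerSeries ℝ) = -X := by
    ext n
    rw [coeff_rescale, map_neg, coeff_X]
    split_ifs with h <;> simp [h]
  have h4 : rescale (-1) theta3Series⁻¹ = theta4Series⁻¹ := by
    ext n
    rw [inv_theta3Series, coeff_rescale, coeff_rescale, ← mul_assoc, ← mul_pow]; simp
  have h : rescale (-1) b3Series = -absB3Series := by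
    rw [b3Series, absB3Series, map_mul, h4, theta2PowSeries, map_mul, map_mul, map_pow, h2, hX,
      map_ofNat]
    ring
  have h' := congrArg (coeff m) h
  rw [coeff_rescale, coeff_b3Series, map_neg] at h'
  rw [← abs_of_nonneg (coeff_absB3Series_nonneg m), ← abs_neg (coeff m absB3Series), ← h',
    abs_mul, abs_pow, abs_neg, abs_one, one_pow, one_mul]

lemma b3_zero : b3 0 = 0 := by
  rw [← coeff_b3Series, b3Series, theta2PowSeries]; simp

lemma a3_nonneg (n : ℕ) : 0 ≤ a3 n := by
  rw [a3]
  rcases Nat.even_or_odd n with h | h <;> rw [h.neg_one_pow] <;> norm_num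

lemma a3_le (n : ℕ) : a3 n ≤ 10 * n ^ 2 := by
  have h1 : (a n : ℝ) ≤ (n : ℝ) ^ 2 := by exact_mod_cast a_le n
  have h0 : (0 : ℝ) ≤ a n := by positivity
  rw [a3]
  rcases Nat.even_or_odd n with h | h <;> rw [h.neg_one_pow] <;> linarith

lemma a3_zero : a3 0 = 0 := by rw [a3, a_zero]; simp

/-- The series `∑ a₃(n) X^n`. -/
def a3Series : PowerSeries ℝ := mk a3

lemma a3Series_eq : a3Series = C 4 * lambertSeries - rescale (-1) lambertSeries := by
  ext n
  rw [map_sub, coeff_C_mul, coeff_rescale, lambertSeries, coeff_mk, a3Series, coeff_mk, a3]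
  ring

lemma convDisc_a3Series : ConvDisc a3Series := by
  rw [a3Series_eq]
  exact ((convDisc_C 4).mul convDisc_lambertSeries).sub convDisc_lambertSeries.rescale_neg_one

/-! ### The theta functions as values of power series -/

lemma summable_theta3 {y : ℝ} (hy : 0 < y) :
    Summable fun n : ℤ => Real.exp (-Real.pi * y * (n : ℝ) ^ 2) := by
  refine (HurwitzZeta.hasSum_int_evenKernel 0 hy).summable.congr fun n => ?_
  congr 1; ring

lemma summable_theta2 {y : ℝ} (hy : 0 < y) :
    Summable fun n : ℤ => Real.exp (-Real.pi * y * ((n : ℝ) - 1 / 2) ^ 2) := by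
  refine (HurwitzZeta.hasSum_int_evenKernel (-1 / 2) hy).summable.congr fun n => ?_
  congr 1; ring

lemma summable_theta4 {y : ℝ} (hy : 0 < y) :
    Summable fun n : ℤ => (-1 : ℝ) ^ n * Real.exp (-Real.pi * y * (n : ℝ) ^ 2) := by
  refine Summable.of_norm ((summable_theta3 hy).congr fun n => ?_)
  rw [norm_mul, norm_zpow, norm_neg, norm_one, one_zpow, one_mul, Real.norm_of_nonneg]
  positivity

lemma hasSum_sq_of_hasSum_int {g : ℤ → ℝ} {v : ℝ} (hg : HasSum g v) (heven : ∀ n, g (-n) = g n) :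
    HasSum (fun k : ℕ => if k = 0 then g 0 else 2 * g k) v := by
  have h := hg.nat_add_neg
  have h2 := h.sub (hasSum_ite_eq 0 (g 0))
  rw [add_sub_cancel_right] at h2
  refine (congrArg (fun F => HasSum F v) (funext fun k => ?_)).mp h2
  rw [heven]
  split_ifs with hk
  · subst hk; simp
  · ring

lemma nome_pow_mul {y : ℝ} (n : ℕ) :
    Real.exp (-Real.pi * y) ^ n = Real.exp (-Real.pi * y * n) := by
  rw [← Real.exp_nat_mul]; ring_nf

/-- Taking ε = ±1 treats θ₃ and θ₄ together; ε^(k²) = ε^k because k² and k have the same parity. -/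
lemma tsum_theta_eq_qval {ε : ℝ} (hε : ε * ε = 1) {y : ℝ} (hy : 0 < y)
    (hf : ConvDisc (rescale ε theta3Series))
    (hs : Summable fun n : ℤ => ε ^ n * Real.exp (-Real.pi * y * (n : ℝ) ^ 2)) :
    ∑' n : ℤ, ε ^ n * Real.exp (-Real.pi * y * (n : ℝ) ^ 2) = qval (rescale ε theta3Series) y := by
  have hε' : ε⁻¹ = ε := inv_eq_of_mul_eq_one_right hε
  have h1 := hasSum_sq_of_hasSum_int hs.hasSum (fun n => by
    rw [zpow_neg, ← inv_zpow, hε']; simp)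
  have hinj : Function.Injective fun k : ℕ => k ^ 2 := Nat.pow_left_injective (by norm_num)
  have h2 := (hinj.hasSum_iff (f := fun n => coeff n (rescale ε theta3Series) *
    Real.exp (-Real.pi * y) ^ n) (fun n hn => ?_)).2 (hf.hasSum hy)
  · refine HasSum.unique h1 ?_
    convert h2 using 2 with k
    simp only [Function.comp, coeff_rescale, theta3Series, coeff_mk, nome_pow_mul]
    have e1 : ε ^ k ^ 2 = ε ^ k := by
      rw [pow_two, pow_mul]
      have hk : ε ^ k * ε ^ k = 1 := by rw [← mul_pow, hε, one_pow]
      rcases Nat.even_or_odd k with ⟨j, hj⟩ | ⟨j, hj⟩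
      · have : ε ^ k = 1 := by rw [hj, pow_add, ← mul_pow, hε, one_pow]
        rw [this, one_pow]
      · have h1 : ε ^ k = ε := by rw [hj, pow_succ, pow_mul, pow_two, hε, one_pow, one_mul]
        rw [h1, h1]
    by_cases h0 : k = 0
    · subst h0; simp
    · rw [if_neg h0, if_neg (by positivity), if_pos ⟨k, rfl⟩, e1]
      push_cast
      rw [zpow_natCast]; ring
  · have hn' : ¬ ∃ k : ℕ, k ^ 2 = n := fun h => hn h
    have h0 : n ≠ 0 := by rintro rfl; exact hn' ⟨0, rfl⟩
    rw [coeff_rescale, theta3Series, coeff_mk, if_neg h0, if_neg hn']; simp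

lemma theta3_eq_qval {y : ℝ} (hy : 0 < y) : theta3 y = qval theta3Series y := by
  have := tsum_theta_eq_qval (ε := 1) (by norm_num) hy
    (by simpa using convDisc_theta3Series) (by simpa using summable_theta3 hy)
  simpa [theta3] using this

lemma theta4_eq_qval {y : ℝ} (hy : 0 < y) : theta4 y = qval theta4Series y :=
  tsum_theta_eq_qval (ε := -1) (by norm_num) hy convDisc_theta4Series (summable_theta4 hy)

lemma theta2_eq_qval {y : ℝ} (hy : 0 < y) :
    theta2 y = 2 * Real.exp (-Real.pi * y / 4) * qval theta2Series y := by
  have hinj : Function.Injective fun k : ℕ => k * (k + 1) := by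
    intro i j h
    simp only at h
    rcases lt_trichotomy i j with h' | h' | h' <;> nlinarith
  have h2 := (hinj.hasSum_iff (f := fun n => coeff n theta2Series *
    Real.exp (-Real.pi * y) ^ n) (fun n hn => ?_)).2 (convDisc_theta2Series.hasSum hy)
  · have h3 := h2.mul_left (Real.exp (-Real.pi * y / 4))
    -- Since (k+1/2)² = k(k+1) + 1/4, after a shift by one the indices k and -(k+1) give equal
    -- terms, hence the factor 2.
    have h4 : HasSum (fun n : ℤ => Real.exp (-Real.pi * y * (((n + 1 : ℤ) : ℝ) - 1 / 2) ^ 2))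
        (Real.exp (-Real.pi * y / 4) * qval theta2Series y +
          Real.exp (-Real.pi * y / 4) * qval theta2Series y) := by
      refine HasSum.of_nat_of_neg_add_one ?_ ?_
      all_goals
        refine (congrArg (fun F => HasSum F _) (funext fun k => ?_)).mp h3
        simp only [Function.comp, theta2Series, coeff_mk, nome_pow_mul]
        rw [if_pos ⟨k, rfl⟩, one_mul, ← Real.exp_add]
        push_cast
        congr 1
        ring
    have h5 := (Equiv.addRight (1 : ℤ)).hasSum_iff (f := fun n : ℤ =>
      Real.exp (-Real.pi * y * ((n : ℝ) - 1 / 2) ^ 2))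
      (a := Real.exp (-Real.pi * y / 4) * qval theta2Series y +
          Real.exp (-Real.pi * y / 4) * qval theta2Series y)
    rw [theta2, (h5.1 h4).tsum_eq]
    ring
  · have hn' : ¬ ∃ k : ℕ, k * (k + 1) = n := fun h => hn h
    rw [theta2Series, coeff_mk, if_neg hn']; simp

/-- The reciprocal power series converges at q, so θ₄ has an inverse there. -/
lemma theta4_ne_zero {y : ℝ} (hy : 0 < y) : theta4 y ≠ 0 := by
  have h := qval_mul convDisc_theta4Series convDisc_inv_theta4Series hy
  rw [theta4Series_mul_inv, qval_one, ← theta4_eq_qval hy] at h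
  exact left_ne_zero_of_mul (h ▸ one_ne_zero)

lemma qval_inv_theta4Series {y : ℝ} (hy : 0 < y) : qval theta4Series⁻¹ y = (theta4 y)⁻¹ := by
  have h := qval_mul convDisc_theta4Series convDisc_inv_theta4Series hy
  rw [theta4Series_mul_inv, qval_one, ← theta4_eq_qval hy] at h
  exact eq_inv_of_mul_eq_one_right h.symm

lemma one_le_theta3 {y : ℝ} (hy : 0 < y) : 1 ≤ theta3 y := by
  have := (summable_theta3 hy).le_tsum 0 (fun _ _ => by positivity)
  simpa [theta3] using this

lemma theta3_pos {y : ℝ} (hy : 0 < y) : 0 < theta3 y := one_pos.trans_le (one_le_theta3 hy)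

lemma exp_le_theta2 {y : ℝ} (hy : 0 < y) : Real.exp (-Real.pi * y / 4) ≤ theta2 y := by
  have := (summable_theta2 hy).le_tsum 0 (fun _ _ => by positivity)
  refine le_trans (le_of_eq ?_) this
  congr 1
  push_cast; ring

lemma theta2_pos {y : ℝ} (hy : 0 < y) : 0 < theta2 y := (Real.exp_pos _).trans_le (exp_le_theta2 hy)

lemma qval_inv_theta3Series {y : ℝ} (hy : 0 < y) : qval theta3Series⁻¹ y = (theta3 y)⁻¹ := by
  have h := qval_mul convDisc_theta3Series convDisc_inv_theta3Series hy
  rw [PowerSeries.mul_inv_cancel _ (by simp [constantCoeff_theta3Series]), qval_one,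
    ← theta3_eq_qval hy] at h
  exact eq_inv_of_mul_eq_one_right h.symm

lemma qval_theta2PowSeries {y : ℝ} (hy : 0 < y) : qval theta2PowSeries y = theta2 y ^ 4 := by
  rw [theta2PowSeries_eq, qval_mul ((convDisc_C 16).mul convDisc_X) (convDisc_theta2Series.pow 4) hy,
    qval_mul (convDisc_C 16) convDisc_X hy, qval_C, qval_X, qval_pow convDisc_theta2Series 4 hy,
    theta2_eq_qval hy, mul_pow, mul_pow, ← Real.exp_nat_mul]
  norm_num
  left
  ring_nf

lemma qval_b3Series {y : ℝ} (hy : 0 < y) : qval b3Series y = (theta3 y)⁻¹ * theta2 y ^ 4 := by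
  rw [b3Series, qval_mul convDisc_inv_theta3Series convDisc_theta2PowSeries hy,
    qval_inv_theta3Series hy, qval_theta2PowSeries hy]

lemma qval_absB3Series {y : ℝ} (hy : 0 < y) :
    qval absB3Series y = (theta4 y)⁻¹ * theta2 y ^ 4 := by
  rw [absB3Series, qval_mul convDisc_inv_theta4Series convDisc_theta2PowSeries hy,
    qval_inv_theta4Series hy, qval_theta2PowSeries hy]

/-! ### Logarithmic derivatives -/

lemma hasDerivAt_theta4 {y : ℝ} (hy : 0 < y) :
    HasDerivAt theta4 (Real.pi * qval lambertSeries y * theta4 y) y := by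
  have h := hasDerivAt_qval convDisc_theta4Series hy
  have h0 : eulerD theta4Series = C (-1) * (lambertSeries * theta4Series) := by
    rw [eulerD_theta4Series]; simp
  rw [h0, qval_mul (convDisc_C _) (convDisc_lambertSeries.mul convDisc_theta4Series) hy, qval_C,
    qval_mul convDisc_lambertSeries convDisc_theta4Series hy, ← theta4_eq_qval hy] at h
  have h2 := h.congr_of_eventuallyEq (f₁ := theta4) (by
    filter_upwards [Ioi_mem_nhds hy] with z hz using theta4_eq_qval hz)
  exact h2.congr_deriv (by ring)

lemma hasDerivAt_theta3 {y : ℝ} (hy : 0 < y) :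
    HasDerivAt theta3 (Real.pi * qval (rescale (-1) lambertSeries) y * theta3 y) y := by
  have h := hasDerivAt_qval convDisc_theta3Series hy
  have h0 : eulerD theta3Series = C (-1) * (rescale (-1) lambertSeries * theta3Series) := by
    rw [eulerD_theta3Series]; simp
  have hc := convDisc_lambertSeries.rescale_neg_one
  rw [h0, qval_mul (convDisc_C _) (hc.mul convDisc_theta3Series) hy, qval_C,
    qval_mul hc convDisc_theta3Series hy, ← theta3_eq_qval hy] at h
  have h2 := h.congr_of_eventuallyEq (f₁ := theta3) (by
    filter_upwards [Ioi_mem_nhds hy] with z hz using theta3_eq_qval hz)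
  exact h2.congr_deriv (by ring)

lemma qval_a3Series {y : ℝ} (hy : 0 < y) :
    qval a3Series y = 4 * qval lambertSeries y - qval (rescale (-1) lambertSeries) y := by
  rw [a3Series_eq, qval_sub ((convDisc_C 4).mul convDisc_lambertSeries)
    convDisc_lambertSeries.rescale_neg_one hy, qval_mul (convDisc_C 4) convDisc_lambertSeries hy,
    qval_C]

lemma logDeriv_theta_eq {y : ℝ} (hy : 0 < y) :
    4 * (deriv theta4 y / theta4 y) - deriv theta3 y / theta3 y = Real.pi * qval a3Series y := by
  rw [(hasDerivAt_theta4 hy).deriv, (hasDerivAt_theta3 hy).deriv, qval_a3Series hy,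
    mul_div_cancel_right₀ _ (theta4_ne_zero hy), mul_div_cancel_right₀ _ (theta3_pos hy).ne']
  ring

lemma hasSum_a3 {y : ℝ} (hy : 0 < y) :
    HasSum (fun n : ℕ => a3 (n + 1) * Real.exp (-Real.pi * y) ^ (n + 1)) (qval a3Series y) := by
  have h := convDisc_a3Series.hasSum hy
  simp only [a3Series, coeff_mk] at h
  rw [← hasSum_nat_add_iff' 1] at h
  simpa [a3_zero, a3Series] using h

lemma hasSum_b3 {y : ℝ} (hy : 0 < y) :
    HasSum (fun n : ℕ => b3 (n + 1) * Real.exp (-Real.pi * y) ^ (n + 1)) (qval b3Series y) := by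
  have h := convDisc_b3Series.hasSum hy
  simp only [coeff_b3Series] at h
  rw [← hasSum_nat_add_iff' 1] at h
  simpa [b3_zero] using h

lemma hasSum_abs_b3 {y : ℝ} (hy : 0 < y) :
    HasSum (fun n : ℕ => |b3 (n + 1)| * Real.exp (-Real.pi * y) ^ (n + 1))
      (qval absB3Series y) := by
  have h := convDisc_absB3Series.hasSum hy
  simp only [← abs_b3] at h
  rw [← hasSum_nat_add_iff' 1] at h
  simpa [b3_zero] using h

/-! ### Jacobi's identity -/

/-- The lattice splits by the parity of m+n. In the new coordinates m²+n² becomes 2(p₁²+p₂²) on the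
even class and 2((p₁-1/2)²+(p₂-1/2)²) on the odd one, which is what doubles y. -/
lemma tsum_int_prod_split {f : ℤ × ℤ → ℝ} (hf : Summable f) :
    ∑' p, f p = ∑' p : ℤ × ℤ, f (p.1 + p.2, p.1 - p.2) +
      ∑' p : ℤ × ℤ, f (p.1 + p.2 - 1, p.1 - p.2) := by
  set φ : ℤ × ℤ → ℤ × ℤ := fun p => (p.1 + p.2, p.1 - p.2) with hφ
  set ψ : ℤ × ℤ → ℤ × ℤ := fun p => (p.1 + p.2 - 1, p.1 - p.2) with hψ
  have hφi : Function.Injective φ := by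
    rintro ⟨a, b⟩ ⟨c, d⟩ h
    simp only [hφ, Prod.mk.injEq] at h ⊢
    omega
  have hψi : Function.Injective ψ := by
    rintro ⟨a, b⟩ ⟨c, d⟩ h
    simp only [hψ, Prod.mk.injEq] at h ⊢
    omega
  have hc : (range φ)ᶜ = range ψ := by
    ext ⟨m, n⟩
    simp only [mem_compl_iff, mem_range, hφ, hψ, Prod.exists, Prod.mk.injEq, not_exists]
    constructor
    · intro h
      have := h ((m + n) / 2) ((m - n) / 2)
      exact ⟨(m + n + 1) / 2, (m - n + 1) / 2, by omega, by omega⟩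
    · rintro ⟨a, b, h1, h2⟩ c d
      omega
  rw [← hf.tsum_subtype_add_tsum_subtype_compl (range φ), hc]
  rw [tsum_range f hφi, tsum_range f hψi]

lemma theta_sq_aux {g h : ℤ → ℝ} (hg : Summable g) (hh : Summable h) :
    (Summable fun p : ℤ × ℤ => g p.1 * h p.2) ∧
      (∑' n, g n) * ∑' n, h n = ∑' p : ℤ × ℤ, g p.1 * h p.2 :=
  ⟨summable_mul_of_summable_norm hg.norm hh.norm, tsum_mul_tsum_of_summable_norm hg.norm hh.norm⟩

lemma theta3_sq {y : ℝ} (hy : 0 < y) :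
    theta3 y ^ 2 = theta3 (2 * y) ^ 2 + theta2 (2 * y) ^ 2 := by
  have hy2 : 0 < 2 * y := by positivity
  obtain ⟨h1, h2⟩ := theta_sq_aux (summable_theta3 hy) (summable_theta3 hy)
  rw [pow_two, pow_two, pow_two, theta3, theta3, theta2, h2, tsum_int_prod_split h1,
    (theta_sq_aux (summable_theta3 hy2) (summable_theta3 hy2)).2,
    (theta_sq_aux (summable_theta2 hy2) (summable_theta2 hy2)).2]
  congr 1 <;>
  · refine tsum_congr fun p => ?_
    rw [← Real.exp_add, ← Real.exp_add]
    push_cast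
    congr 1
    ring

lemma neg_one_zpow_mul_eq_of_even {m n : ℤ} (h : Even (m + n)) : (-1 : ℝ) ^ m * (-1) ^ n = 1 := by
  rw [← zpow_add₀ (by norm_num), h.neg_one_zpow]

lemma neg_one_zpow_mul_eq_of_odd {m n : ℤ} (h : Odd (m + n)) : (-1 : ℝ) ^ m * (-1) ^ n = -1 := by
  rw [← zpow_add₀ (by norm_num), h.neg_one_zpow]

lemma theta4_sq {y : ℝ} (hy : 0 < y) :
    theta4 y ^ 2 = theta3 (2 * y) ^ 2 - theta2 (2 * y) ^ 2 := by
  have hy2 : 0 < 2 * y := by positivity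
  obtain ⟨h1, h2⟩ := theta_sq_aux (summable_theta4 hy) (summable_theta4 hy)
  rw [pow_two, pow_two, pow_two, theta3, theta4, theta2, h2, tsum_int_prod_split h1,
    (theta_sq_aux (summable_theta3 hy2) (summable_theta3 hy2)).2,
    (theta_sq_aux (summable_theta2 hy2) (summable_theta2 hy2)).2, sub_eq_add_neg, ← tsum_neg]
  congr 1
  · refine tsum_congr fun p => ?_
    rw [mul_mul_mul_comm, neg_one_zpow_mul_eq_of_even ⟨p.1, by ring⟩, one_mul,
      ← Real.exp_add, ← Real.exp_add]
    push_cast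
    congr 1
    ring
  · refine tsum_congr fun p => ?_
    rw [mul_mul_mul_comm, neg_one_zpow_mul_eq_of_odd ⟨p.1 - 1, by ring⟩, neg_one_mul,
      ← Real.exp_add, ← Real.exp_add]
    push_cast
    congr 2
    ring

lemma theta2_sq {y : ℝ} (hy : 0 < y) :
    theta2 y ^ 2 = 2 * (theta2 (2 * y) * theta3 (2 * y)) := by
  have hy2 : 0 < 2 * y := by positivity
  obtain ⟨h1, h2⟩ := theta_sq_aux (summable_theta2 hy) (summable_theta2 hy)
  rw [pow_two, two_mul, theta2, h2, tsum_int_prod_split h1]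
  congr 1
  · rw [theta2, theta3, (theta_sq_aux (summable_theta2 hy2) (summable_theta3 hy2)).2]
    refine tsum_congr fun p => ?_
    rw [← Real.exp_add, ← Real.exp_add]
    push_cast
    congr 1
    ring
  -- On the odd class the form is 2((p₁-1)² + (p₂-1/2)²), so the θ₂ and θ₃ factors are swapped and
  -- p₁ is shifted.
  · rw [mul_comm (theta2 _), theta2, theta3,
      (theta_sq_aux (summable_theta3 hy2) (summable_theta2 hy2)).2,
      ← ((Equiv.subRight (1 : ℤ)).prodCongr (Equiv.refl ℤ)).tsum_eq (fun p : ℤ × ℤ =>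
        Real.exp (-Real.pi * (2 * y) * (p.1 : ℝ) ^ 2) *
        Real.exp (-Real.pi * (2 * y) * ((p.2 : ℝ) - 1 / 2) ^ 2))]
    refine tsum_congr fun p => ?_
    rw [← Real.exp_add, ← Real.exp_add]
    simp only [Equiv.prodCongr_apply, Prod.map, Equiv.subRight_apply, Equiv.refl_apply]
    push_cast
    congr 1
    ring

/-- With A = θ₃(2y)² and B = θ₂(2y)² this is (A+B)² = 4AB + (A-B)². -/
lemma jacobi_identity {y : ℝ} (hy : 0 < y) : theta3 y ^ 4 = theta2 y ^ 4 + theta4 y ^ 4 := by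
  have h3 := theta3_sq hy
  have h4 := theta4_sq hy
  have h2 := theta2_sq hy
  have e3 : theta3 y ^ 4 = (theta3 y ^ 2) ^ 2 := by ring
  have e2 : theta2 y ^ 4 = (theta2 y ^ 2) ^ 2 := by ring
  have e4 : theta4 y ^ 4 = (theta4 y ^ 2) ^ 2 := by ring
  rw [e3, e2, e4, h3, h4, h2]
  ring

/-! ### Inversion formulas -/

lemma evenKernel_zero_eq {y : ℝ} (hy : 0 < y) : HurwitzZeta.evenKernel 0 y = theta3 y := by
  have h := HurwitzZeta.hasSum_int_evenKernel 0 hy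
  rw [QuotientAddGroup.mk_zero] at h
  rw [← h.tsum_eq, theta3]
  refine tsum_congr fun n => ?_
  congr 1; ring

lemma evenKernel_half_eq {y : ℝ} (hy : 0 < y) :
    HurwitzZeta.evenKernel ((-1 / 2 : ℝ) : UnitAddCircle) y = theta2 y := by
  have h := HurwitzZeta.hasSum_int_evenKernel (-1 / 2) hy
  rw [← h.tsum_eq, theta2]
  refine tsum_congr fun n => ?_
  congr 1; ring

/-- The character e^(2πian) at a = -1/2 is (-1)ⁿ, so the functional equation of the Hurwitz kernels
exchanges θ₂ and θ₄. -/
lemma cosKernel_half_eq {y : ℝ} (hy : 0 < y) :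
    HurwitzZeta.cosKernel ((-1 / 2 : ℝ) : UnitAddCircle) y = theta4 y := by
  have h := HurwitzZeta.hasSum_int_cosKernel (-1 / 2) hy
  have h2 := Complex.hasSum_ofReal.2 (summable_theta4 hy).hasSum
  have h3 : (HurwitzZeta.cosKernel ((-1 / 2 : ℝ) : UnitAddCircle) y : ℂ) = (theta4 y : ℂ) := by
    refine h.unique ?_
    rw [theta4]
    convert h2 using 2 with n
    have : Complex.exp (2 * Real.pi * Complex.I * ((-1 / 2 : ℝ) : ℂ) * n) = (-1 : ℂ) ^ n := by
      rw [show (2 * Real.pi * Complex.I * ((-1 / 2 : ℝ) : ℂ) * n) =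
        n * (-(Real.pi * Complex.I)) by push_cast; ring, Complex.exp_int_mul, Complex.exp_neg,
        Complex.exp_pi_mul_I]
      norm_num
    rw [this]
    push_cast
    congr 2
    ring_nf
  exact_mod_cast h3

lemma theta3_inv {y : ℝ} (hy : 0 < y) : theta3 y⁻¹ = y ^ (1 / 2 : ℝ) * theta3 y := by
  have h := HurwitzZeta.evenKernel_functional_equation 0 y
  rw [← HurwitzZeta.evenKernel_eq_cosKernel_of_zero, one_div y, evenKernel_zero_eq hy,
    evenKernel_zero_eq (inv_pos.2 hy)] at h
  have := (Real.rpow_pos_of_pos hy (1 / 2)).ne'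
  rw [h]; field_simp

lemma theta4_inv {y : ℝ} (hy : 0 < y) : theta4 y⁻¹ = y ^ (1 / 2 : ℝ) * theta2 y := by
  have h := HurwitzZeta.evenKernel_functional_equation ((-1 / 2 : ℝ) : UnitAddCircle) y
  rw [one_div y, evenKernel_half_eq hy, cosKernel_half_eq (inv_pos.2 hy)] at h
  have := (Real.rpow_pos_of_pos hy (1 / 2)).ne'
  rw [h]; field_simp

lemma theta2_inv {y : ℝ} (hy : 0 < y) : theta2 y⁻¹ = y ^ (1 / 2 : ℝ) * theta4 y := by
  have h := theta4_inv (inv_pos.2 hy)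
  rw [inv_inv, Real.inv_rpow hy.le] at h
  have := (Real.rpow_pos_of_pos hy (1 / 2)).ne'
  rw [h]; field_simp

open Filter Topology Asymptotics

/-! ### The function `F₃` -/

lemma F3_eq_sub {y : ℝ} (hy : 0 < y) : F3 y = theta3 y ^ 3 - qval b3Series y := by
  have := (theta3_pos hy).ne'
  rw [F3, lam, qval_b3Series hy]
  field_simp

lemma F3_eq_div {y : ℝ} (hy : 0 < y) : F3 y = theta4 y ^ 4 / theta3 y := by
  have := (theta3_pos hy).ne'
  rw [F3_eq_sub hy, qval_b3Series hy]
  field_simp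
  linear_combination jacobi_identity hy

lemma hasDerivAt_F3 {y : ℝ} (hy : 0 < y) :
    HasDerivAt F3 (Real.pi * qval a3Series y * F3 y) y := by
  have h3 := (theta3_pos hy).ne'
  have h := ((hasDerivAt_theta4 hy).pow 4).div (hasDerivAt_theta3 hy) h3
  have h2 := h.congr_of_eventuallyEq (f₁ := F3) (by
    filter_upwards [Ioi_mem_nhds hy] with z hz using F3_eq_div hz)
  refine h2.congr_deriv ?_
  rw [F3_eq_div hy, qval_a3Series hy]
  simp only [Pi.pow_apply]
  field_simp
  push_cast
  ring

lemma rpow_half_pow (y : ℝ) (hy : 0 < y) (k : ℕ) : (y ^ (1 / 2 : ℝ)) ^ k = y ^ ((k : ℝ) / 2) := by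
  rw [← Real.rpow_natCast, ← Real.rpow_mul hy.le]; ring_nf

/-- Four factors y^(1/2) from θ₂⁴ and one inverse factor from θ₃⁻¹ leave y^(3/2). -/
lemma qval_b3Series_inv {y : ℝ} (hy : 0 < y) :
    qval b3Series y⁻¹ = y ^ (3 / 2 : ℝ) * F3 y := by
  have h3 := (theta3_pos hy).ne'
  have hp := (Real.rpow_pos_of_pos hy (1 / 2)).ne'
  rw [qval_b3Series (inv_pos.2 hy), theta3_inv hy, theta2_inv hy, F3_eq_div hy, mul_pow,
    show (3 / 2 : ℝ) = ((3 : ℕ) : ℝ) / 2 by norm_num, ← rpow_half_pow y hy]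
  field_simp

lemma F3_eq {y : ℝ} (hy : 0 < y) : F3 y = y ^ (-(3 / 2) : ℝ) * qval b3Series y⁻¹ := by
  rw [qval_b3Series_inv hy, ← mul_assoc, ← Real.rpow_add hy]; simp

lemma qval_b3Series_eq {y : ℝ} (hy : 0 < y) :
    qval b3Series y = y ^ (-(3 / 2) : ℝ) * F3 y⁻¹ := by
  rw [F3_eq (inv_pos.2 hy), inv_inv, ← mul_assoc, Real.inv_rpow hy.le, ← Real.rpow_neg hy.le,
    ← Real.rpow_add hy]; simp

lemma qval_absB3Series_inv {y : ℝ} (hy : 0 < y) :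
    qval absB3Series y⁻¹ = y ^ (3 / 2 : ℝ) * (theta4 y ^ 4 / theta2 y) := by
  have h3 := (theta2_pos hy).ne'
  have hp := (Real.rpow_pos_of_pos hy (1 / 2)).ne'
  rw [qval_absB3Series (inv_pos.2 hy), theta4_inv hy, theta2_inv hy, mul_pow,
    show (3 / 2 : ℝ) = ((3 : ℕ) : ℝ) / 2 by norm_num, ← rpow_half_pow y hy]
  field_simp

lemma differentiableOn_F3 : DifferentiableOn ℝ F3 (Ioi 0) :=
  fun _ hy => (hasDerivAt_F3 hy).differentiableAt.differentiableWithinAt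

lemma continuousOn_deriv_F3 : ContinuousOn (deriv F3) (Ioi 0) := by
  have : ContinuousOn (fun y => Real.pi * qval a3Series y * F3 y) (Ioi 0) :=
    (continuousOn_const.mul (continuousOn_qval convDisc_a3Series)).mul
      differentiableOn_F3.continuousOn
  exact this.congr fun y hy => (hasDerivAt_F3 hy).deriv

/-! ### Rapid decay -/

/-- Decay at `∞` faster than every power. -/
def RapidAtTop (g : ℝ → ℝ) : Prop := ∀ k : ℝ, g =O[atTop] fun x => x ^ k

/-- Decay at `0` faster than every power. -/
def RapidAtZero (g : ℝ → ℝ) : Prop := ∀ k : ℝ, g =O[𝓝[>] 0] fun x => x ^ k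

lemma rapidAtTop_exp {c : ℝ} (hc : 0 < c) : RapidAtTop fun x => Real.exp (-c * x) :=
  fun k => (isLittleO_exp_neg_mul_rpow_atTop hc k).isBigO

lemma RapidAtTop.rpow_mul {g : ℝ → ℝ} (hg : RapidAtTop g) (ρ : ℝ) :
    RapidAtTop fun x => x ^ ρ * g x := by
  intro k
  refine ((isBigO_refl (fun x : ℝ => x ^ ρ) atTop).mul (hg (k - ρ))).congr' EventuallyEq.rfl ?_
  filter_upwards [eventually_gt_atTop 0] with x hx
  rw [← Real.rpow_add hx]; ring_nf

lemma RapidAtZero.rpow_mul {g : ℝ → ℝ} (hg : RapidAtZero g) (ρ : ℝ) :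
    RapidAtZero fun x => x ^ ρ * g x := by
  intro k
  refine ((isBigO_refl (fun x : ℝ => x ^ ρ) _).mul (hg (k - ρ))).congr' EventuallyEq.rfl ?_
  filter_upwards [self_mem_nhdsWithin] with x hx
  rw [← Real.rpow_add hx]; ring_nf

lemma RapidAtTop.of_le {g h : ℝ → ℝ} (hg : RapidAtTop g) (c : ℝ)
    (hle : ∀ x, 1 ≤ x → |h x| ≤ c * |g x|) : RapidAtTop h := fun k =>
  (IsBigO.of_bound c (by
    filter_upwards [eventually_ge_atTop 1] with x hx using by simpa using hle x hx)).trans (hg k)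

lemma RapidAtTop.inv {g : ℝ → ℝ} (hg : RapidAtTop fun x => g x⁻¹) : RapidAtZero g := by
  intro k
  have h := (hg (-k)).comp_tendsto tendsto_inv_nhdsGT_zero
  refine h.congr' ?_ ?_
  · exact Eventually.of_forall fun x => by simp
  · filter_upwards [self_mem_nhdsWithin] with x hx
    have hx' : (0 : ℝ) < x := hx
    simp only [Function.comp]
    rw [Real.inv_rpow hx'.le, Real.rpow_neg hx'.le, inv_inv]

lemma rapidAtTop_qval {f : PowerSeries ℝ} (hf : ConvDisc f) (h0 : coeff 0 f = 0) :
    RapidAtTop (qval f) := by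
  obtain ⟨c, _, h⟩ := abs_qval_le hf h0
  exact (rapidAtTop_exp Real.pi_pos).of_le c fun x hx => by
    rw [abs_of_pos (Real.exp_pos _)]; exact h x hx

lemma coeff_zero_a3Series : coeff 0 a3Series = 0 := by rw [a3Series, coeff_mk, a3_zero]

lemma coeff_zero_absB3Series : coeff 0 absB3Series = 0 := by rw [← abs_b3, b3_zero, abs_zero]

lemma coeff_zero_b3Series : coeff 0 b3Series = 0 := by rw [coeff_b3Series, b3_zero]

/-! ### A majorant for the double series -/

lemma qval_a3Series_le :
    ∃ c : ℝ, ∀ y : ℝ, 0 < y → qval a3Series y ≤ c * (y⁻¹) ^ 4 := by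
  -- Here 240 = 10·4!: the bound e^(-x) ≤ 4!/x⁴ against a₃(n) ≤ 10n² leaves ∑1/n².
  refine ⟨∑' n : ℕ, 240 / ((n : ℝ) + 1) ^ 2, fun y hy => ?_⟩
  have hs : Summable fun n : ℕ => 240 / ((n : ℝ) + 1) ^ 2 := by
    have := (summable_nat_add_iff 1).2 (Real.summable_one_div_nat_pow.2 (by norm_num : 1 < 2))
    simpa [div_eq_mul_inv] using this.mul_left 240
  rw [← (hasSum_a3 hy).tsum_eq, ← tsum_mul_right]
  refine (hasSum_a3 hy).summable.tsum_le_tsum (fun n => ?_) (hs.mul_right _)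
  have h1 := a3_le (n + 1)
  have hx : 0 < ((n : ℝ) + 1) * y := by positivity
  have h2 := Real.pow_div_factorial_le_exp (((n : ℝ) + 1) * y) hx.le 4
  have h3 : Real.exp (-Real.pi * y) ^ (n + 1) ≤ 24 / (((n : ℝ) + 1) * y) ^ 4 := by
    rw [← Real.exp_nat_mul]
    have h4 : ((n + 1 : ℕ) : ℝ) * (-Real.pi * y) ≤ -(((n : ℝ) + 1) * y) := by
      push_cast
      nlinarith [Real.pi_gt_three]
    refine (Real.exp_le_exp.2 h4).trans ?_
    rw [Real.exp_neg, inv_le_comm₀ (Real.exp_pos _) (by positivity), inv_div]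
    exact h2
  calc _ ≤ 10 * ((n + 1 : ℕ) : ℝ) ^ 2 * (24 / (((n : ℝ) + 1) * y) ^ 4) := by gcongr
    _ = _ := by
      push_cast
      field_simp
      norm_num

/-- The sum of the absolute values of the terms of the double series for `F₃'`, up to a power
of `y`. -/
def majorant (y : ℝ) : ℝ := qval a3Series y * qval absB3Series y⁻¹

lemma qval_a3Series_nonneg (y : ℝ) : 0 ≤ qval a3Series y :=
  qval_nonneg (fun n => by rw [a3Series, coeff_mk]; exact a3_nonneg n) y

lemma qval_absB3Series_nonneg (y : ℝ) : 0 ≤ qval absB3Series y :=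
  qval_nonneg coeff_absB3Series_nonneg y

lemma majorant_nonneg (y : ℝ) : 0 ≤ majorant y :=
  mul_nonneg (qval_a3Series_nonneg y) (qval_absB3Series_nonneg _)

/-- Near 0 the a₃ factor grows polynomially in 1/y, while the other factor is exponentially small in
1/y. -/
lemma rapidAtZero_majorant : RapidAtZero majorant := by
  apply RapidAtTop.inv
  obtain ⟨c, hc⟩ := qval_a3Series_le
  have h := (rapidAtTop_qval convDisc_absB3Series coeff_zero_absB3Series).rpow_mul 4
  refine h.of_le c fun x hx => ?_
  have hx0 : 0 < x := by linarith
  rw [abs_of_nonneg (majorant_nonneg _), majorant, inv_inv, abs_of_nonneg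
    (mul_nonneg (by positivity) (qval_absB3Series_nonneg x)), ← mul_assoc]
  refine mul_le_mul_of_nonneg_right ?_ (qval_absB3Series_nonneg x)
  have := hc x⁻¹ (inv_pos.2 hx0)
  rw [inv_inv] at this
  exact_mod_cast this

/-- Inversion produces θ₄⁴/θ₂, at most a constant times e^(πx/4). The factor e^(-πx) from a₃ leaves
e^(-3πx/4), of which the rate π/2 is a convenient weakening. -/
lemma rapidAtTop_majorant : RapidAtTop majorant := by
  obtain ⟨c, hc0, hc⟩ := abs_qval_le convDisc_a3Series coeff_zero_a3Series
  obtain ⟨d, hd0, hd⟩ := abs_qval_le (convDisc_theta4Series.sub convDisc_one) (by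
    rw [map_sub, coeff_zero_eq_constantCoeff_apply, constantCoeff_theta4Series]; simp)
  have h := (rapidAtTop_exp (c := Real.pi / 2) (by positivity)).rpow_mul (3 / 2)
  refine h.of_le (c * (1 + d) ^ 4) fun x hx => ?_
  have hx0 : 0 < x := by linarith
  have h2 := exp_le_theta2 hx0
  have h4 : |theta4 x| ≤ 1 + d := by
    have := hd x hx
    rw [qval_sub convDisc_theta4Series convDisc_one hx0, qval_one, ← theta4_eq_qval hx0] at this
    have h5 : d * Real.exp (-Real.pi * x) ≤ d * 1 :=
      mul_le_mul_of_nonneg_left (nome_lt_one hx0).le hd0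
    calc |theta4 x| = |1 + (theta4 x - 1)| := by ring_nf
      _ ≤ |(1 : ℝ)| + |theta4 x - 1| := abs_add_le _ _
      _ ≤ _ := by rw [abs_one]; linarith
  rw [abs_of_nonneg (majorant_nonneg _), majorant, qval_absB3Series_inv hx0,
    abs_of_nonneg (by positivity)]
  have h6 : theta4 x ^ 4 / theta2 x ≤ (1 + d) ^ 4 * Real.exp (Real.pi * x / 4) := by
    rw [div_le_iff₀ (theta2_pos hx0)]
    have h7 : 1 ≤ Real.exp (Real.pi * x / 4) * theta2 x := by
      calc 1 = Real.exp (Real.pi * x / 4) * Real.exp (-Real.pi * x / 4) := by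
            rw [← Real.exp_add, ← Real.exp_zero]; congr 1; ring
        _ ≤ _ := by gcongr
    have h8 : theta4 x ^ 4 ≤ (1 + d) ^ 4 := by
      rw [← abs_of_nonneg (by positivity : 0 ≤ theta4 x ^ 4), abs_pow]
      exact pow_le_pow_left₀ (abs_nonneg _) h4 4
    calc theta4 x ^ 4 ≤ (1 + d) ^ 4 * 1 := by rwa [mul_one]
      _ ≤ (1 + d) ^ 4 * (Real.exp (Real.pi * x / 4) * theta2 x) := by gcongr
      _ = _ := by ring
  have h9 : Real.exp (-Real.pi * x) * Real.exp (Real.pi * x / 4) ≤ Real.exp (-(Real.pi / 2) * x) := by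
    rw [← Real.exp_add]
    apply Real.exp_le_exp.2
    nlinarith [mul_pos Real.pi_pos hx0]
  calc qval a3Series x * (x ^ (3 / 2 : ℝ) * (theta4 x ^ 4 / theta2 x))
      ≤ (c * Real.exp (-Real.pi * x)) *
        (x ^ (3 / 2 : ℝ) * ((1 + d) ^ 4 * Real.exp (Real.pi * x / 4))) := by
        have h10 := (le_abs_self _).trans (hc x hx)
        have := theta2_pos hx0
        gcongr
    _ = c * (1 + d) ^ 4 * (x ^ (3 / 2 : ℝ) *
        (Real.exp (-Real.pi * x) * Real.exp (Real.pi * x / 4))) := by ring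
    _ ≤ _ := by gcongr

lemma continuousOn_majorant : ContinuousOn majorant (Ioi 0) :=
  (continuousOn_qval convDisc_a3Series).mul
    ((continuousOn_qval convDisc_absB3Series).comp
      (continuousOn_inv₀.mono fun _ hx => ne_of_gt hx) fun _ hx => mem_Ioi.2 (inv_pos.2 hx))

lemma abs_qval_b3Series_le {y : ℝ} (hy : 0 < y) : |qval b3Series y| ≤ qval absB3Series y := by
  rw [← Real.norm_eq_abs]
  refine tsum_of_norm_bounded (convDisc_absB3Series.hasSum hy) fun n => ?_
  rw [norm_mul, Real.norm_eq_abs, coeff_b3Series, abs_b3, Real.norm_of_nonneg (by positivity)]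

lemma abs_deriv_F3_le {y : ℝ} (hy : 0 < y) :
    |deriv F3 y| ≤ Real.pi * |y ^ (-(3 / 2) : ℝ) * majorant y| := by
  rw [(hasDerivAt_F3 hy).deriv, F3_eq hy, abs_mul, abs_mul, abs_mul, abs_mul, majorant, abs_mul,
    abs_of_pos Real.pi_pos, abs_of_nonneg (qval_absB3Series_nonneg y⁻¹)]
  have := abs_qval_b3Series_le (inv_pos.2 hy)
  calc _ ≤ Real.pi * |qval a3Series y| * (|y ^ (-(3 / 2) : ℝ)| * qval absB3Series y⁻¹) := by gcongr
    _ = _ := by ring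

lemma rapidAtTop_deriv_F3 : RapidAtTop (deriv F3) :=
  (rapidAtTop_majorant.rpow_mul (-(3 / 2))).of_le Real.pi fun _ hx =>
    abs_deriv_F3_le (one_pos.trans_le hx)

lemma rapidAtZero_deriv_F3 : RapidAtZero (deriv F3) := fun k =>
  (IsBigO.of_bound Real.pi (by
    filter_upwards [self_mem_nhdsWithin] with x hx using abs_deriv_F3_le hx)).trans
    (rapidAtZero_majorant.rpow_mul (-(3 / 2)) k)

lemma rapidAtZero_F3 : RapidAtZero F3 := by
  apply RapidAtTop.inv
  refine ((rapidAtTop_qval convDisc_b3Series coeff_zero_b3Series).rpow_mul (3 / 2)).of_le 1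
    fun x hx => ?_
  have hx0 : 0 < x := by linarith
  rw [F3_eq (inv_pos.2 hx0), inv_inv, Real.inv_rpow hx0.le, Real.rpow_neg hx0.le, inv_inv, one_mul]

/-- The function is the value of θ₃³ - 1 - θ₃⁻¹θ₂⁴, a power series in q without constant term. -/
lemma rapidAtTop_F3_sub_one : RapidAtTop fun y => F3 y - 1 := by
  have hc := ((convDisc_theta3Series.pow 3).sub convDisc_one).sub convDisc_b3Series
  refine (rapidAtTop_qval hc ?_).of_le 1 fun x hx => ?_
  · rw [map_sub, coeff_zero_b3Series, map_sub, coeff_zero_eq_constantCoeff_apply,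
      coeff_zero_eq_constantCoeff_apply, map_pow, constantCoeff_theta3Series]
    simp
  · have hx0 : 0 < x := by linarith
    rw [qval_sub ((convDisc_theta3Series.pow 3).sub convDisc_one) convDisc_b3Series hx0,
      qval_sub (convDisc_theta3Series.pow 3) convDisc_one hx0, qval_one,
      qval_pow convDisc_theta3Series 3 hx0, ← theta3_eq_qval hx0, F3_eq_sub hx0, one_mul]
    apply le_of_eq
    congr 1
    ring

/-! ### The Bessel series for `Ψ₃` -/

lemma mellinConvergent_of_rapid {g : ℝ → ℝ} (hc : ContinuousOn g (Ioi 0)) (h0 : RapidAtZero g)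
    (h1 : RapidAtTop g) (s : ℂ) : MellinConvergent (fun y => (g y : ℂ)) s := by
  refine mellinConvergent_of_isBigO_rpow (a := s.re + 1) (b := s.re - 1)
    ((Complex.continuous_ofReal.comp_continuousOn hc).locallyIntegrableOn measurableSet_Ioi)
    ?_ (by linarith) ?_ (by linarith)
  · exact (IsBigO.of_norm_left (by simpa using (h1 (-(s.re + 1))).norm_left))
  · exact (IsBigO.of_norm_left (by simpa using (h0 (-(s.re - 1))).norm_left))

lemma differentiable_mellin_of_rapid {g : ℝ → ℝ} (hc : ContinuousOn g (Ioi 0))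
    (h0 : RapidAtZero g) (h1 : RapidAtTop g) :
    Differentiable ℂ (mellin (fun y => (g y : ℂ))) := fun s => by
  refine mellin_differentiableAt_of_isBigO_rpow (a := s.re + 1) (b := s.re - 1)
    ((Complex.continuous_ofReal.comp_continuousOn hc).locallyIntegrableOn measurableSet_Ioi)
    ?_ (by linarith) ?_ (by linarith)
  · exact (IsBigO.of_norm_left (by simpa using (h1 (-(s.re + 1))).norm_left))
  · exact (IsBigO.of_norm_left (by simpa using (h0 (-(s.re - 1))).norm_left))

lemma Psi3_eq_mellin (s : ℂ) : Psi3 s = mellin (fun y => ((deriv F3 y : ℝ) : ℂ)) (3 * s / 2 + 1) := by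
  rw [Psi3, mellin]
  simp only [add_sub_cancel_right, smul_eq_mul]

lemma integrableOn_Psi3 (s : ℂ) :
    IntegrableOn (fun y : ℝ => (y : ℂ) ^ (3 * s / 2) * ((deriv F3 y : ℝ) : ℂ)) (Ioi 0) := by
  have := mellinConvergent_of_rapid continuousOn_deriv_F3 rapidAtZero_deriv_F3
    rapidAtTop_deriv_F3 (3 * s / 2 + 1)
  simpa only [MellinConvergent, add_sub_cancel_right, smul_eq_mul] using this

lemma differentiable_Psi3 : Differentiable ℂ Psi3 := by
  have h := differentiable_mellin_of_rapid continuousOn_deriv_F3 rapidAtZero_deriv_F3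
    rapidAtTop_deriv_F3
  have : Psi3 = (mellin fun y => ((deriv F3 y : ℝ) : ℂ)) ∘ fun s => 3 * s / 2 + 1 :=
    funext Psi3_eq_mellin
  rw [this]
  exact h.comp (by fun_prop)

/-- The terms of the double series of `F₃'`. -/
def doubleTerm (p : ℕ × ℕ) (y : ℝ) : ℝ :=
  Real.pi * y ^ (-(3 / 2) : ℝ) * ((a3 (p.1 + 1) * Real.exp (-Real.pi * y) ^ (p.1 + 1)) *
    (b3 (p.2 + 1) * Real.exp (-Real.pi * y⁻¹) ^ (p.2 + 1)))

lemma hasSum_mul_prod {f g : ℕ → ℝ} {u v : ℝ} (hf : HasSum f u) (hg : HasSum g v) :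
    HasSum (fun p : ℕ × ℕ => f p.1 * g p.2) (u * v) :=
  hf.mul hg (summable_mul_of_summable_norm hf.summable.norm hg.summable.norm)

lemma hasSum_doubleTerm {y : ℝ} (hy : 0 < y) :
    HasSum (fun p => doubleTerm p y) (deriv F3 y) := by
  have h1 := hasSum_a3 hy
  have h2 := hasSum_b3 (inv_pos.2 hy)
  have h3 := (hasSum_mul_prod h1 h2).mul_left
    (Real.pi * y ^ (-(3 / 2) : ℝ))
  have e : deriv F3 y = Real.pi * y ^ (-(3 / 2) : ℝ) *
      (qval a3Series y * qval b3Series y⁻¹) := by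
    rw [(hasDerivAt_F3 hy).deriv, F3_eq hy]; ring
  rw [e]
  unfold doubleTerm
  exact h3

lemma hasSum_abs_doubleTerm {y : ℝ} (hy : 0 < y) :
    HasSum (fun p => |doubleTerm p y|) (Real.pi * y ^ (-(3 / 2) : ℝ) * majorant y) := by
  have h1 := hasSum_a3 hy
  have h2 := hasSum_abs_b3 (inv_pos.2 hy)
  have h3 := (hasSum_mul_prod h1 h2).mul_left
    (Real.pi * y ^ (-(3 / 2) : ℝ))
  refine (congrArg (fun F => HasSum F _) (funext fun p => ?_)).mp h3
  rw [doubleTerm, abs_mul, abs_mul (a3 _ * _), abs_mul (b3 _),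
    abs_of_nonneg (by positivity : 0 ≤ Real.pi * y ^ (-(3 / 2) : ℝ)),
    abs_of_nonneg (mul_nonneg (a3_nonneg _) (by positivity)),
    abs_of_nonneg (by positivity : 0 ≤ Real.exp (-Real.pi * y⁻¹) ^ (p.2 + 1))]

lemma hasSum_integral_doubleTerm (s : ℂ) :
    HasSum (fun p : ℕ × ℕ => ∫ y in Ioi (0 : ℝ), (y : ℂ) ^ (3 * s / 2) * (doubleTerm p y : ℂ))
      (Psi3 s) := by
  have hcp : ContinuousOn (fun y : ℝ => (y : ℂ) ^ (3 * s / 2)) (Ioi 0) := fun y hy =>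
    (Complex.continuousAt_ofReal_cpow_const _ _ (Or.inr (ne_of_gt hy))).continuousWithinAt
  have hpos : ∀ᵐ y ∂(volume.restrict (Ioi (0 : ℝ))), 0 < y :=
    (ae_restrict_iff' measurableSet_Ioi).2 (Eventually.of_forall fun _ h => h)
  refine hasSum_integral_of_dominated_convergence
    (fun p y => y ^ (3 * s / 2).re * |doubleTerm p y|) (fun p => ?_) (fun p => ?_) ?_ ?_ ?_
  · refine ContinuousOn.aestronglyMeasurable (hcp.mul ?_) measurableSet_Ioi
    refine Complex.continuous_ofReal.comp_continuousOn ?_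
    have hr : ContinuousOn (fun y : ℝ => y ^ (-(3 / 2) : ℝ)) (Ioi 0) := fun y hy =>
      (Real.continuousAt_rpow_const _ _ (Or.inl (ne_of_gt hy))).continuousWithinAt
    have hi : ContinuousOn (fun y : ℝ => y⁻¹) (Ioi 0) :=
      continuousOn_inv₀.mono fun _ hx => ne_of_gt hx
    unfold doubleTerm
    fun_prop
  · filter_upwards [hpos] with y hy
    rw [norm_mul, Complex.norm_cpow_eq_rpow_re_of_pos hy, Complex.norm_real, Real.norm_eq_abs]
  · filter_upwards [hpos] with y hy
    exact (hasSum_abs_doubleTerm hy).summable.mul_left _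
  -- In the exponent, -3/2 is the power of y in `doubleTerm`, and +1 offsets the -1 in the Mellin
  -- kernel.
  · have h := (mellinConvergent_of_rapid continuousOn_majorant rapidAtZero_majorant
      rapidAtTop_majorant (((3 * s / 2).re - 3 / 2 + 1 : ℝ))).norm
    refine (h.const_mul Real.pi).congr ?_
    filter_upwards [hpos] with y hy
    rw [tsum_mul_left, (hasSum_abs_doubleTerm hy).tsum_eq, norm_smul,
      Complex.norm_cpow_eq_rpow_re_of_pos hy, Complex.norm_real,
      Real.norm_of_nonneg (majorant_nonneg y)]
    have : (((3 * s / 2).re - 3 / 2 + 1 : ℝ) - 1 : ℂ).re = (3 * s / 2).re + -(3 / 2) := by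
      rw [Complex.sub_re, Complex.ofReal_re, Complex.one_re]; ring
    rw [this, Real.rpow_add hy]
    ring
  · filter_upwards [hpos] with y hy
    exact (Complex.hasSum_ofReal.2 (hasSum_doubleTerm hy)).mul_left _

/-- The substitution y = cu with c = √(M/N) equalises Nc = M/c = √(NM), giving the symmetric
exponent of K; the scaling contributes c^w = (M/N)^(w/2). -/
lemma integral_bessel (w : ℂ) {N M : ℝ} (hN : 0 < N) (hM : 0 < M) :
    ∫ y in Ioi (0 : ℝ), (y : ℂ) ^ (w - 1) *
        ((Real.exp (-Real.pi * (N * y + M * y⁻¹)) : ℝ) : ℂ) =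
      2 * (((M : ℂ) / N) ^ (w / 2) * besselK w (2 * Real.pi * Real.sqrt (N * M))) := by
  set c := Real.sqrt (M / N) with hc
  have hc0 : 0 < c := Real.sqrt_pos.2 (by positivity)
  have h := integral_comp_mul_left_Ioi (fun y : ℝ => (y : ℂ) ^ (w - 1) *
    ((Real.exp (-Real.pi * (N * y + M * y⁻¹)) : ℝ) : ℂ)) 0 hc0
  rw [mul_zero, eq_inv_smul_iff₀ hc0.ne'] at h
  rw [← h]
  have hcsq : c * c = M / N := Real.mul_self_sqrt (by positivity)
  have e1 : N * c = Real.sqrt (N * M) := by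
    rw [eq_comm, Real.sqrt_eq_iff_mul_self_eq (by positivity) (by positivity)]
    have : N * c * (N * c) = N * N * (c * c) := by ring
    rw [this, hcsq]; field_simp
  have e2 : M * c⁻¹ = Real.sqrt (N * M) := by
    rw [← e1]
    have : M = N * (c * c) := by rw [hcsq]; field_simp
    calc M * c⁻¹ = N * (c * c) * c⁻¹ := by rw [← this]
      _ = N * c := by field_simp
  have e3 : ((M : ℂ) / N) ^ (w / 2) = (c : ℂ) * (c : ℂ) ^ (w - 1) := by
    have hcc : (c : ℂ) ≠ 0 := by exact_mod_cast hc0.ne'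
    rw [← Complex.ofReal_div, ← hcsq, Complex.ofReal_mul,
      Complex.mul_cpow_ofReal_nonneg hc0.le hc0.le, ← Complex.cpow_add _ _ hcc,
      Complex.cpow_sub _ _ hcc, Complex.cpow_one, mul_div_cancel₀ _ hcc]
    congr 1; ring
  rw [besselK, e3, Complex.real_smul]
  have e4 : ∫ y in Ioi (0 : ℝ), ((c * y : ℝ) : ℂ) ^ (w - 1) *
        ((Real.exp (-Real.pi * (N * (c * y) + M * (c * y)⁻¹)) : ℝ) : ℂ) =
      (c : ℂ) ^ (w - 1) * ∫ u in Ioi (0 : ℝ), (u : ℂ) ^ (w - 1) *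
        ((Real.exp (-(2 * Real.pi * Real.sqrt (N * M) / 2) * (u + 1 / u)) : ℝ) : ℂ) := by
    rw [← integral_const_mul]
    refine setIntegral_congr_fun measurableSet_Ioi fun y hy => ?_
    have hy0 : (0 : ℝ) < y := hy
    rw [Complex.ofReal_mul, Complex.mul_cpow_ofReal_nonneg hc0.le hy0.le, mul_assoc]
    congr 3
    rw [mul_inv, ← mul_assoc, ← mul_assoc, e1, e2]
    congr 1
    ring
  rw [e4]
  ring

lemma integral_doubleTerm (s : ℂ) (p : ℕ × ℕ) :
    ∫ y in Ioi (0 : ℝ), (y : ℂ) ^ (3 * s / 2) * (doubleTerm p y : ℂ) =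
      2 * (Real.pi : ℂ) * ((a3 (p.1 + 1) : ℂ) * (b3 (p.2 + 1) : ℂ) *
        (((p.2 + 1 : ℕ) : ℂ) / ((p.1 + 1 : ℕ) : ℂ)) ^ ((3 * s - 1) / 4) *
        besselK ((3 * s - 1) / 2)
          (2 * Real.pi * Real.sqrt (((p.1 + 1) * (p.2 + 1) : ℕ) : ℝ))) := by
  have h := integral_bessel ((3 * s - 1) / 2) (N := ((p.1 + 1 : ℕ) : ℝ))
    (M := ((p.2 + 1 : ℕ) : ℝ)) (by positivity) (by positivity)
  have e : ∫ y in Ioi (0 : ℝ), (y : ℂ) ^ (3 * s / 2) * (doubleTerm p y : ℂ) =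
      ((Real.pi : ℂ) * (a3 (p.1 + 1) : ℂ) * (b3 (p.2 + 1) : ℂ)) *
      ∫ y in Ioi (0 : ℝ), (y : ℂ) ^ ((3 * s - 1) / 2 - 1) *
        ((Real.exp (-Real.pi * (((p.1 + 1 : ℕ) : ℝ) * y + ((p.2 + 1 : ℕ) : ℝ) * y⁻¹)) : ℝ) : ℂ) := by
    rw [← integral_const_mul]
    refine setIntegral_congr_fun measurableSet_Ioi fun y hy => ?_
    have hy0 : (0 : ℝ) < y := hy
    have hyc : (y : ℂ) ≠ 0 := by exact_mod_cast hy0.ne'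
    have e1 : Real.exp (-Real.pi * (((p.1 + 1 : ℕ) : ℝ) * y + ((p.2 + 1 : ℕ) : ℝ) * y⁻¹)) =
        Real.exp (-Real.pi * y) ^ (p.1 + 1) * Real.exp (-Real.pi * y⁻¹) ^ (p.2 + 1) := by
      rw [← Real.exp_nat_mul, ← Real.exp_nat_mul, ← Real.exp_add]; ring_nf
    have e2 : (y : ℂ) ^ ((3 * s - 1) / 2 - 1) =
        (y : ℂ) ^ (3 * s / 2) * ((y ^ (-(3 / 2) : ℝ) : ℝ) : ℂ) := by
      rw [Complex.ofReal_cpow hy0.le, ← Complex.cpow_add _ _ hyc]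
      congr 1
      push_cast; ring
    rw [e1, e2, doubleTerm]
    push_cast
    ring
  rw [e, h]
  push_cast
  rw [show (3 * s - 1) / 2 / 2 = (3 * s - 1) / 4 by ring]
  ring

/-- Unconditional summation allows regrouping along the hyperbolas nm = j. -/
lemma hasSum_divisors {h : ℕ → ℕ → ℂ} {v : ℂ}
    (hs : HasSum (fun p : ℕ × ℕ => h (p.1 + 1) (p.2 + 1)) v) :
    HasSum (fun j : ℕ => ∑ d ∈ (j + 1).divisors, h d ((j + 1) / d)) v := by
  have h1 : HasSum (fun p : ℕ+ × ℕ+ => h p.1 p.2) v := by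
    rw [← (Equiv.pnatEquivNat.symm.prodCongr Equiv.pnatEquivNat.symm).hasSum_iff]
    simpa [Function.comp_def] using hs
  rw [← sigmaAntidiagonalEquivProd.hasSum_iff] at h1
  have h2 := h1.sigma (fun n => hasSum_fintype _)
  rw [← Equiv.pnatEquivNat.symm.hasSum_iff] at h2
  refine (congrArg (fun F => HasSum F v) (funext fun j => ?_)).mp h2
  rw [← Nat.sum_divisorsAntidiagonal, ← Finset.sum_coe_sort]
  rfl

lemma hasSum_Psi3 (s : ℂ) :
    HasSum (fun j : ℕ => 2 * (Real.pi : ℂ) * (c3 (j + 1) s *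
      besselK ((3 * s - 1) / 2) (2 * Real.pi * Real.sqrt ((j + 1 : ℕ) : ℝ)))) (Psi3 s) := by
  have h := hasSum_integral_doubleTerm s
  simp only [integral_doubleTerm] at h
  have h2 := hasSum_divisors (h := fun n m => 2 * (Real.pi : ℂ) * ((a3 n : ℂ) * (b3 m : ℂ) *
        ((m : ℂ) / (n : ℂ)) ^ ((3 * s - 1) / 4) *
        besselK ((3 * s - 1) / 2) (2 * Real.pi * Real.sqrt ((n * m : ℕ) : ℝ)))) h
  refine (congrArg (fun F => HasSum F _) (funext fun j => ?_)).mp h2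
  rw [c3, Finset.sum_mul, Finset.mul_sum]
  refine Finset.sum_congr rfl fun d hd => ?_
  have hd1 := Nat.dvd_of_mem_divisors hd
  have hd0 : (d : ℂ) ≠ 0 := by exact_mod_cast (Nat.pos_of_mem_divisors hd).ne'
  rw [Nat.mul_div_cancel' hd1, Nat.cast_div hd1 hd0, div_div, ← pow_two]

/-! ### Integration by parts and the zeta function -/

lemma tendsto_cpow_mul_zero {l : Filter ℝ} (hl : ∀ᶠ y in l, 0 < y) {g : ℝ → ℂ} {w : ℂ} {k : ℝ}
    (hg : g =O[l] fun x => x ^ (-k)) (hlim : Tendsto (fun x : ℝ => x ^ (w.re - k)) l (𝓝 0)) :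
    Tendsto (fun y : ℝ => (y : ℂ) ^ w * g y) l (𝓝 0) := by
  have h1 : (fun y : ℝ => (y : ℂ) ^ w) =O[l] fun y => y ^ w.re :=
    IsBigO.of_bound 1 (by
      filter_upwards [hl] with y hy
      rw [Complex.norm_cpow_eq_rpow_re_of_pos hy, one_mul]
      exact le_abs_self _)
  refine ((h1.mul hg).congr' EventuallyEq.rfl ?_).trans_tendsto hlim
  filter_upwards [hl] with y hy
  rw [← Real.rpow_add hy, sub_eq_add_neg]

/-- The condition k₀ < Re w < k₁ kills the boundary terms y^w g(y) at both ends. -/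
lemma mellin_by_parts {g g' : ℝ → ℂ} {w : ℂ} (hw : w ≠ 0) {k₀ k₁ : ℝ}
    (hd : ∀ y, 0 < y → HasDerivAt g (g' y) y)
    (h1 : g =O[atTop] fun x => x ^ (-k₁)) (hk₁ : w.re < k₁)
    (h0 : g =O[𝓝[>] 0] fun x => x ^ (-k₀)) (hk₀ : k₀ < w.re)
    (hg' : MellinConvergent g' (w + 1)) :
    MellinConvergent g w ∧ mellin g w = -(mellin g' (w + 1) / w) := by
  have hcont : ContinuousOn g (Ioi 0) := fun y hy => (hd y hy).continuousAt.continuousWithinAt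
  have hconv : MellinConvergent g w := mellinConvergent_of_isBigO_rpow
    (hcont.locallyIntegrableOn measurableSet_Ioi) h1 hk₁ h0 hk₀
  refine ⟨hconv, ?_⟩
  have ht1 := tendsto_cpow_mul_zero (w := w) (eventually_gt_atTop 0) h1
    (by rw [← neg_sub]; exact tendsto_rpow_neg_atTop (by linarith))
  have ht0 := tendsto_cpow_mul_zero (w := w) (l := 𝓝[>] 0) self_mem_nhdsWithin h0 (by
    have := (Real.continuousAt_rpow_const 0 (w.re - k₀) (Or.inr (by linarith))).tendsto
    rw [Real.zero_rpow (by linarith)] at this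
    exact this.mono_left nhdsWithin_le_nhds)
  -- Since `0 ^ w = 0` for w ≠ 0, the arbitrary value `g 0` does not matter and the antiderivative
  -- is continuous at 0.
  have hz : ((0 : ℝ) : ℂ) ^ w * g 0 = 0 := by simp [Complex.zero_cpow hw]
  have hi1 : IntegrableOn (fun y : ℝ => w * ((y : ℂ) ^ (w - 1) • g y)) (Ioi 0) :=
    Integrable.const_mul hconv w
  have hi2 : IntegrableOn (fun y : ℝ => (y : ℂ) ^ (w + 1 - 1) • g' y) (Ioi 0) := hg'
  have key := integral_Ioi_of_hasDerivAt_of_tendsto (a := (0 : ℝ)) (m := (0 : ℂ))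
    (f := fun y : ℝ => (y : ℂ) ^ w * g y)
    (f' := fun y : ℝ => w * ((y : ℂ) ^ (w - 1) • g y) + (y : ℂ) ^ (w + 1 - 1) • g' y)
    (continuousWithinAt_Ioi_iff_Ici.1 (by
      unfold ContinuousWithinAt
      simp only [hz]
      exact ht0))
    (fun y hy => by
      refine ((hasDerivAt_ofReal_cpow_const (ne_of_gt hy) hw).mul (hd y hy)).congr_deriv ?_
      rw [add_sub_cancel_right, smul_eq_mul, smul_eq_mul, mul_assoc])
    (hi1.add hi2) ht1
  rw [integral_add hi1 hi2, integral_const_mul] at key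
  simp only [hz, sub_zero] at key
  rw [mellin, mellin]
  field_simp
  linear_combination key

lemma three_mul_div_two_ne {s : ℂ} (hs : s ≠ 0) : 3 * s / 2 ≠ 0 := by simpa using hs

lemma three_mul_div_two_re (s : ℂ) : (3 * s / 2).re = 3 / 2 * s.re := by
  rw [show 3 * s / 2 = ((3 / 2 : ℝ) : ℂ) * s by push_cast; ring, Complex.re_ofReal_mul]

lemma isBigO_one_rpow_zero (l : Filter ℝ) : (fun _ : ℝ => (1 : ℝ)) =O[l] fun x => x ^ (0 : ℝ) := by
  simpa using isBigO_refl (fun _ : ℝ => (1 : ℝ)) l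

lemma isBigO_ofReal {g h : ℝ → ℝ} {l : Filter ℝ} (hg : g =O[l] h) :
    (fun y => (g y : ℂ)) =O[l] h :=
  IsBigO.of_norm_left (by simpa using hg.norm_left)

lemma mellinConvergent_deriv_F3 (w : ℂ) : MellinConvergent (fun y => ((deriv F3 y : ℝ) : ℂ)) w :=
  mellinConvergent_of_rapid continuousOn_deriv_F3 rapidAtZero_deriv_F3 rapidAtTop_deriv_F3 w

lemma hasDerivAt_F3' {y : ℝ} (hy : 0 < y) : HasDerivAt F3 (deriv F3 y) y :=
  (hasDerivAt_F3 hy).differentiableAt.hasDerivAt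

lemma mellin_F3_sub_one {s : ℂ} (hs : 0 < s.re) :
    MellinConvergent (fun y => ((F3 y - 1 : ℝ) : ℂ)) (3 * s / 2) ∧
      mellin (fun y => ((F3 y - 1 : ℝ) : ℂ)) (3 * s / 2) = -(2 / 3 * (Psi3 s / s)) := by
  have hs0 : s ≠ 0 := by rintro rfl; simp at hs
  have h := mellin_by_parts (g := fun y => ((F3 y - 1 : ℝ) : ℂ))
    (g' := fun y => ((deriv F3 y : ℝ) : ℂ)) (three_mul_div_two_ne hs0)
    (k₀ := 0) (k₁ := (3 * s / 2).re + 1)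
    (fun y hy => ((hasDerivAt_F3' hy).sub_const 1).ofReal_comp)
    (isBigO_ofReal (rapidAtTop_F3_sub_one _)) (by linarith)
    (isBigO_ofReal (by
      rw [neg_zero]; exact (rapidAtZero_F3 0).sub (isBigO_one_rpow_zero _)))
    (by rw [three_mul_div_two_re]; linarith) (mellinConvergent_deriv_F3 _)
  refine ⟨h.1, ?_⟩
  rw [h.2, ← Psi3_eq_mellin]
  field_simp

/-- F₃ and F₃ - 1 have the same derivative, hence the same formula as in `mellin_F3_sub_one`; but F₃
tends to 1 at ∞, which moves the range of convergence to Re s < 0. -/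
lemma mellin_F3 {s : ℂ} (hs : s.re < 0) :
    MellinConvergent (fun y => ((F3 y : ℝ) : ℂ)) (3 * s / 2) ∧
      mellin (fun y => ((F3 y : ℝ) : ℂ)) (3 * s / 2) = -(2 / 3 * (Psi3 s / s)) := by
  have hs0 : s ≠ 0 := by rintro rfl; simp at hs
  have h := mellin_by_parts (g := fun y => ((F3 y : ℝ) : ℂ))
    (g' := fun y => ((deriv F3 y : ℝ) : ℂ)) (three_mul_div_two_ne hs0)
    (k₁ := 0) (k₀ := (3 * s / 2).re - 1)
    (fun y hy => (hasDerivAt_F3' hy).ofReal_comp)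
    (isBigO_ofReal (by
      rw [neg_zero]
      simpa using (rapidAtTop_F3_sub_one 0).add (isBigO_one_rpow_zero _)))
    (by rw [three_mul_div_two_re]; linarith)
    (isBigO_ofReal (rapidAtZero_F3 _)) (by linarith) (mellinConvergent_deriv_F3 _)
  refine ⟨h.1, ?_⟩
  rw [h.2, ← Psi3_eq_mellin]
  field_simp

lemma mellin_inversion {g : ℝ → ℂ} {s : ℂ} (hg : MellinConvergent g (3 * (1 - s) / 2)) :
    MellinConvergent (fun y => (y : ℂ) ^ (-(3 / 2) : ℂ) • g y⁻¹) (3 * s / 2) ∧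
      mellin (fun y => (y : ℂ) ^ (-(3 / 2) : ℂ) • g y⁻¹) (3 * s / 2) =
        mellin g (3 * (1 - s) / 2) := by
  have e : -(3 * s / 2 + -(3 / 2)) = 3 * (1 - s) / 2 := by ring
  constructor
  · rw [MellinConvergent.cpow_smul]
    have h := MellinConvergent.comp_rpow (f := g) (s := 3 * s / 2 + -(3 / 2)) (a := -1) (by norm_num)
    simp only [Real.rpow_neg_one] at h
    rw [h]
    convert hg using 1
    rw [← e]; push_cast; ring
  · rw [mellin_cpow_smul, mellin_comp_inv, e]

/-- The term θ₃³λ = θ₃⁻¹θ₂⁴ equals y^(-3/2)F₃(1/y), so the integrand splits into two parts exchanged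
by inversion. -/
lemma stripIntegrand_eq (s : ℂ) {y : ℝ} (hy : 0 < y) :
    stripIntegrand s y = (y : ℂ) ^ (3 * s / 2 - 1) • ((F3 y - 1 : ℝ) : ℂ) +
      (y : ℂ) ^ (3 * s / 2 - 1) • ((y : ℂ) ^ (-(3 / 2) : ℂ) • ((F3 y⁻¹ - 1 : ℝ) : ℂ)) := by
  have h : (y : ℂ) ^ (-(3 / 2) : ℂ) = ((y ^ (-(3 / 2) : ℝ) : ℝ) : ℂ) := by
    rw [Complex.ofReal_cpow hy.le]; norm_num
  have e : theta3 y ^ 3 = F3 y + y ^ (-(3 / 2) : ℝ) * F3 y⁻¹ := by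
    rw [← qval_b3Series_eq hy, F3_eq_sub hy]; ring
  rw [stripIntegrand, h, e]
  simp only [smul_eq_mul]
  push_cast
  ring

lemma halfPlaneIntegrand_eq (s : ℂ) {y : ℝ} (hy : 0 < y) :
    halfPlaneIntegrand s y = (y : ℂ) ^ (3 * s / 2 - 1) • ((F3 y - 1 : ℝ) : ℂ) +
      (y : ℂ) ^ (3 * s / 2 - 1) • ((y : ℂ) ^ (-(3 / 2) : ℂ) • ((F3 y⁻¹ : ℝ) : ℂ)) := by
  have h : (y : ℂ) ^ (-(3 / 2) : ℂ) = ((y ^ (-(3 / 2) : ℝ) : ℝ) : ℂ) := by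
    rw [Complex.ofReal_cpow hy.le]; norm_num
  have e : theta3 y ^ 3 = F3 y + y ^ (-(3 / 2) : ℝ) * F3 y⁻¹ := by
    rw [← qval_b3Series_eq hy, F3_eq_sub hy]; ring
  rw [halfPlaneIntegrand, h, e]
  simp only [smul_eq_mul]
  push_cast
  ring

lemma integral_of_mellin_add {f g h : ℝ → ℂ} {w u v : ℂ}
    (hf : ∀ y, 0 < y → f y = (y : ℂ) ^ (w - 1) • g y + (y : ℂ) ^ (w - 1) • h y)
    (hg : MellinConvergent g w ∧ mellin g w = u) (hh : MellinConvergent h w ∧ mellin h w = v) :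
    IntegrableOn f (Ioi 0) ∧ ∫ y in Ioi (0 : ℝ), f y = u + v := by
  have hadd := Integrable.add hg.1 hh.1
  constructor
  · exact hadd.congr ((ae_restrict_iff' measurableSet_Ioi).2
      (Eventually.of_forall fun y hy => (hf y hy).symm))
  · rw [setIntegral_congr_fun measurableSet_Ioi hf, integral_add hg.1 hh.1, ← hg.2, ← hh.2]
    rfl

lemma integral_stripIntegrand {s : ℂ} (h0 : 0 < s.re) (h1 : s.re < 1) :
    IntegrableOn (stripIntegrand s) (Ioi 0) ∧
      ∫ y in Ioi (0 : ℝ), stripIntegrand s y =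
        -(2 / 3 * (Psi3 s / s)) + -(2 / 3 * (Psi3 (1 - s) / (1 - s))) := by
  have hb := mellin_F3_sub_one (s := 1 - s) (by simpa using h1)
  have hc := mellin_inversion hb.1
  exact integral_of_mellin_add (fun y hy => stripIntegrand_eq s hy) (mellin_F3_sub_one h0)
    ⟨hc.1, hc.2.trans hb.2⟩

/-- Now Re(1-s) < 0, so the inverted part uses `mellin_F3` without the -1; this matches the absence
of y^(-3/2) in the integrand, and the value is the same expression as in the strip. -/
lemma integral_halfPlaneIntegrand {s : ℂ} (h1 : 1 < s.re) :
    IntegrableOn (halfPlaneIntegrand s) (Ioi 0) ∧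
      ∫ y in Ioi (0 : ℝ), halfPlaneIntegrand s y =
        -(2 / 3 * (Psi3 s / s)) + -(2 / 3 * (Psi3 (1 - s) / (1 - s))) := by
  have hb := mellin_F3 (s := 1 - s) (by simpa using h1)
  have hc := mellin_inversion hb.1
  exact integral_of_mellin_add (fun y hy => halfPlaneIntegrand_eq s hy)
    (mellin_F3_sub_one (one_pos.trans h1)) ⟨hc.1, hc.2.trans hb.2⟩

/-! ### Meromorphic continuation and uniqueness -/

/-- The meromorphic continuation of `ζ*(s, 3)`. -/
def zetaStar3 (s : ℂ) : ℂ := -(1 / 9) * (Psi3 s / s + Psi3 (1 - s) / (1 - s))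

lemma differentiableOn_zetaStar3 : DifferentiableOn ℂ zetaStar3 {0, 1}ᶜ := by
  intro s hs
  simp only [mem_compl_iff, mem_insert_iff, mem_singleton_iff, not_or] at hs
  have h1 : 1 - s ≠ 0 := sub_ne_zero.2 (Ne.symm hs.2)
  have hP : Differentiable ℂ fun s : ℂ => Psi3 (1 - s) := differentiable_Psi3.comp (by fun_prop)
  exact (((differentiable_Psi3 s).div differentiableAt_id hs.1).add
    ((hP s).div (by fun_prop) h1)).const_mul _ |>.differentiableWithinAt

lemma isZetaStar3_zetaStar3 : IsZetaStar3 zetaStar3 where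
  meromorphic := by
    intro s _
    have h1 : MeromorphicAt Psi3 s := (differentiable_Psi3.analyticAt s).meromorphicAt
    have h2 : MeromorphicAt (fun s => Psi3 (1 - s)) s :=
      ((differentiable_Psi3.comp (by fun_prop : Differentiable ℂ fun s : ℂ => 1 - s)).analyticAt
        s).meromorphicAt
    have h3 : MeromorphicAt (fun s : ℂ => s) s := MeromorphicAt.id s
    have h4 : MeromorphicAt (fun s : ℂ => 1 - s) s := (MeromorphicAt.const 1 s).sub h3
    exact (MeromorphicAt.const _ s).mul ((h1.div h3).add (h2.div h4))
  holomorphic := differentiableOn_zetaStar3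
  eq_integral := by
    intro s h0 h1
    rw [(integral_stripIntegrand h0 h1).2, zetaStar3]
    ring

/-- The plane without two points is connected, and both functions equal the strip integral near 1/2,
so the identity theorem applies. -/
lemma IsZetaStar3.eq_zetaStar3 {Z : ℂ → ℂ} (hZ : IsZetaStar3 Z) {s : ℂ} (h0 : s ≠ 0)
    (h1 : s ≠ 1) : Z s = zetaStar3 s := by
  have hopen : IsOpen ({0, 1}ᶜ : Set ℂ) := (Set.toFinite {0, 1}).isClosed.isOpen_compl
  have hconn : IsPreconnected ({0, 1}ᶜ : Set ℂ) :=
    ((Set.toFinite {0, 1}).countable.isPathConnected_compl_of_one_lt_rank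
      (by rw [Complex.rank_real_complex]; norm_num)).isConnected.isPreconnected
  have hmem : (1 / 2 : ℂ) ∈ ({0, 1}ᶜ : Set ℂ) := by
    simp only [mem_compl_iff, mem_insert_iff, mem_singleton_iff, not_or]
    norm_num
  have hstrip : {z : ℂ | 0 < z.re ∧ z.re < 1} ∈ 𝓝 (1 / 2 : ℂ) := by
    refine IsOpen.mem_nhds ?_ ?_
    · exact (isOpen_lt continuous_const Complex.continuous_re).inter
        (isOpen_lt Complex.continuous_re continuous_const)
    · constructor <;> norm_num
  refine AnalyticOnNhd.eqOn_of_preconnected_of_eventuallyEq (hZ.holomorphic.analyticOnNhd hopen)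
    (differentiableOn_zetaStar3.analyticOnNhd hopen) hconn hmem ?_ (by simp [h0, h1])
  filter_upwards [hstrip] with z hz
  rw [hZ.eq_integral z hz.1 hz.2, isZetaStar3_zetaStar3.eq_integral z hz.1 hz.2]

end

end BesselZeta


theorem mainTheorem5 :
    -- `a₃` and `b₃` are the coefficients of the stated `q`-expansions
    (∀ y : ℝ, 0 < y →
      HasSum (fun n : ℕ =>
          Real.pi * (BesselZeta.a3 (n + 1) * Real.exp (-Real.pi * y) ^ (n + 1)))
        (4 * (deriv BesselZeta.theta4 y / BesselZeta.theta4 y)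
          - deriv BesselZeta.theta3 y / BesselZeta.theta3 y)) ∧
    (∀ y : ℝ, 0 < y →
      HasSum (fun m : ℕ => BesselZeta.b3 (m + 1) * Real.exp (-Real.pi * y) ^ (m + 1))
        ((BesselZeta.theta3 y)⁻¹ * BesselZeta.theta2 y ^ 4)) ∧
    -- `Ψ₃` is well defined and has the Bessel series expansion, for every complex `s`
    DifferentiableOn ℝ BesselZeta.F3 (Ioi 0) ∧
    (∀ s : ℂ,
      IntegrableOn
        (fun y : ℝ => (y : ℂ) ^ (3 * s / 2) * ((deriv BesselZeta.F3 y : ℝ) : ℂ)) (Ioi 0) ∧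
      HasSum (fun j : ℕ => 2 * (Real.pi : ℂ) * (BesselZeta.c3 (j + 1) s *
          BesselZeta.besselK ((3 * s - 1) / 2) (2 * Real.pi * Real.sqrt ((j + 1 : ℕ) : ℝ))))
        (BesselZeta.Psi3 s)) ∧
    -- `ζ*(s, 3)` is well defined
    (∀ s : ℂ, 0 < s.re → s.re < 1 →
      IntegrableOn (BesselZeta.stripIntegrand s) (Ioi 0)) ∧
    (∀ s : ℂ, 1 < s.re → IntegrableOn (BesselZeta.halfPlaneIntegrand s) (Ioi 0)) ∧
    (∃ Z : ℂ → ℂ, BesselZeta.IsZetaStar3 Z) ∧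
    -- the formulas for `ζ*(s, 3)`
    (∀ Z : ℂ → ℂ, BesselZeta.IsZetaStar3 Z →
      (∀ s : ℂ, 1 < s.re →
        Z s = (1 / 6) * ∫ y in Ioi (0 : ℝ), BesselZeta.halfPlaneIntegrand s y) ∧
      (∀ s : ℂ, s ≠ 0 → s ≠ 1 →
        9 * Z s = -(BesselZeta.Psi3 s / s + BesselZeta.Psi3 (1 - s) / (1 - s)))) := by
  refine ⟨fun y hy => ?_, fun y hy => ?_, BesselZeta.differentiableOn_F3,
    fun s => ⟨BesselZeta.integrableOn_Psi3 s, BesselZeta.hasSum_Psi3 s⟩,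
    fun s h0 h1 => (BesselZeta.integral_stripIntegrand h0 h1).1,
    fun s h1 => (BesselZeta.integral_halfPlaneIntegrand h1).1,
    ⟨_, BesselZeta.isZetaStar3_zetaStar3⟩, fun Z hZ => ⟨fun s h1 => ?_, fun s h0 h1 => ?_⟩⟩
  · rw [BesselZeta.logDeriv_theta_eq hy]
    exact (BesselZeta.hasSum_a3 hy).mul_left _
  · rw [← BesselZeta.qval_b3Series hy]
    exact BesselZeta.hasSum_b3 hy
  · have h0 : s ≠ 0 := by rintro rfl; norm_num at h1
    have h2 : s ≠ 1 := by rintro rfl; norm_num at h1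
    rw [hZ.eq_zetaStar3 h0 h2, (BesselZeta.integral_halfPlaneIntegrand h1).2, BesselZeta.zetaStar3]
    ring
  · rw [hZ.eq_zetaStar3 h0 h1, BesselZeta.zetaStar3]
    ring
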